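/- Let $N\ge 1$, let $X\subset\mathbb R^N$ be a compact set, let $\mu$ be a Borel probability measure on $X$ and let $T\colon X\to X$ be a Lipschitz map. Assume that $\mu$ is $T$-invariant or that $T$ is bi-Lipschitz onto its image. Fix an integer $k\ge 1$ and assume $$\mu\Big(\bigcup_{p=1}^{k-1}\{x\in X: T^p x=x\}\Big)=0$$ (no condition if $k=1$). For a finite Borel measure $\nu$ and a point $y$ of its support let $$\underline d(\nu,y)=\liminf_{\delta\to0^+}\frac{\log \nu(B(y,\delta))}{\log\delta},\qquad \overline d(\nu,y)=\limsup_{\delta\to0^+}\frac{\log \nu(B(y,\delta))}{\log\delta};$$ if they are equal, their common value is the local dimension $d(\nu,y)$. Suppose that $d(\mu,x)$ exists for $\mu$-almost every $x\in X$. For $h\colon X\to\mathbb R$ let $\phi_h\colon X\to\mathbb R^k$, $\phi_h(x)=(h(x),h(Tx),\dots,h(T^{k-1}x))$, be the $k$-delay coordinate map, and let $\phi_h\mu$ be the push-forward of $\mu$ under $\phi_h$. Then for a prevalent Lipschitz observable $h\colon X\to\mathbb R$, for $\mu$-almost every $x\in X$ the local dimension $d(\phi_h\mu,\phi_h(x))$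 exists and $$d(\phi_h\mu,\phi_h(x))=\min\{k,d(\mu,x)\}.$$ Here prevalence is understood in the Banach space $V=\mathrm{Lip}(X)$ of Lipschitz functions $h\colon X\to\mathbb R$ with norm $\|h\|=\sup_{x}|h(x)|+\sup_{x\ne y}\frac{|h(x)-h(y)|}{\|x-y\|}$: a set $S\subset V$ is prevalent if it contains a Borel set $B\subset V$ for which there is a Borel measure $\nu$ on $V$, positive and finite on some compact subset of $V$, such that for every $v\in V$ we have $v+e\in B$ for $\nu$-almost every $e\in V$. -/

import Mathlib

open MeasureTheory Filter Topology

noncomputable section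

/-- The real vector space of all Lipschitz functions `h : X → ℝ`, as a subspace of `X → ℝ`. -/
def lipSubmodule (X : Type*) [MetricSpace X] : Submodule ℝ (X → ℝ) where
  carrier := {h | ∃ K : NNReal, LipschitzWith K h}
  zero_mem' := ⟨0, LipschitzWith.const 0⟩
  add_mem' := by
    rintro f g ⟨K, hf⟩ ⟨L, hg⟩
    exact ⟨K + L, hf.add hg⟩
  smul_mem' := by
    rintro c f ⟨K, hf⟩
    refine ⟨‖c‖₊ * K, LipschitzWith.of_dist_le_mul fun x y => ?_⟩
    have h := hf.dist_le_mul x y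
    rw [Real.dist_eq] at h ⊢
    have e : (c • f) x - (c • f) y = c * (f x - f y) := by
      simp only [Pi.smul_apply, smul_eq_mul]; ring
    rw [e, abs_mul, NNReal.coe_mul, coe_nnnorm, Real.norm_eq_abs, mul_assoc]
    exact mul_le_mul_of_nonneg_left h (abs_nonneg c)

/-- The space `Lip(X)` of Lipschitz functions `h : X → ℝ`. It is a type of its own, so that it
carries the topology of the Lipschitz norm and not that of pointwise convergence. -/
def LipFun (X : Type*) [MetricSpace X] : Type _ := ↥(lipSubmodule X)

namespace LipFun

variable {X : Type*} [MetricSpace X]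

instance : AddCommGroup (LipFun X) := inferInstanceAs (AddCommGroup ↥(lipSubmodule X))

instance : Module ℝ (LipFun X) := inferInstanceAs (Module ℝ ↥(lipSubmodule X))

instance : CoeFun (LipFun X) (fun _ => X → ℝ) := ⟨fun h => h.1⟩

theorem ext {f g : LipFun X} (h : ∀ x, f x = g x) : f = g := Subtype.ext (funext h)

theorem add_apply (f g : LipFun X) (x : X) : (f + g) x = f x + g x := rfl

theorem sub_apply (f g : LipFun X) (x : X) : (f - g) x = f x - g x := rfl

theorem smul_apply (c : ℝ) (f : LipFun X) (x : X) : (c • f) x = c * f x := rfl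

theorem zero_apply (x : X) : (0 : LipFun X) x = 0 := rfl

/-- The supremum `sup_x |h x|`. -/
def supNorm (h : LipFun X) : ℝ := ⨆ x : X, |h x|

/-- The least Lipschitz constant `Lip(h) = sup_{x ≠ y} |h x - h y| / dist x y`. -/
def lipConst (h : LipFun X) : ℝ :=
  ⨆ p : {p : X × X // p.1 ≠ p.2}, |h p.1.1 - h p.1.2| / dist p.1.1 p.1.2

/-- The Lipschitz norm `‖h‖ = sup_x |h x| + Lip(h)`. -/
instance : Norm (LipFun X) := ⟨fun h => h.supNorm + h.lipConst⟩

theorem norm_def (h : LipFun X) : ‖h‖ = h.supNorm + h.lipConst := rfl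

theorem supNorm_nonneg (h : LipFun X) : 0 ≤ h.supNorm := Real.iSup_nonneg fun _ => abs_nonneg _

theorem lipConst_nonneg (h : LipFun X) : 0 ≤ h.lipConst :=
  Real.iSup_nonneg fun _ => div_nonneg (abs_nonneg _) dist_nonneg

theorem bddAbove_slope (h : LipFun X) : BddAbove (Set.range
    fun p : {p : X × X // p.1 ≠ p.2} => |h p.1.1 - h p.1.2| / dist p.1.1 p.1.2) := by
  obtain ⟨K, hK⟩ := h.2
  refine ⟨K, ?_⟩
  rintro _ ⟨p, rfl⟩
  have := hK.dist_le_mul p.1.1 p.1.2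
  rw [Real.dist_eq] at this
  exact (div_le_iff₀ (dist_pos.2 p.2)).2 this

theorem abs_sub_le (h : LipFun X) (x y : X) : |h x - h y| ≤ h.lipConst * dist x y := by
  by_cases e : x = y
  · subst e; simp
  · exact (div_le_iff₀ (dist_pos.2 e)).1 (le_ciSup h.bddAbove_slope ⟨(x, y), e⟩)

theorem supNorm_le {h : LipFun X} {a : ℝ} (ha : 0 ≤ a) (H : ∀ x, |h x| ≤ a) : h.supNorm ≤ a :=
  Real.iSup_le H ha

theorem lipConst_le {h : LipFun X} {a : ℝ} (ha : 0 ≤ a)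
    (H : ∀ x y, |h x - h y| ≤ a * dist x y) : h.lipConst ≤ a :=
  Real.iSup_le (fun p => (div_le_iff₀ (dist_pos.2 p.2)).2 (H _ _)) ha

variable [CompactSpace X]

theorem bddAbove_abs (h : LipFun X) : BddAbove (Set.range fun x : X => |h x|) := by
  obtain ⟨K, hK⟩ := h.2
  exact (isCompact_range hK.continuous.abs).bddAbove

theorem abs_le_supNorm (h : LipFun X) (x : X) : |h x| ≤ h.supNorm := le_ciSup h.bddAbove_abs x

theorem normCore : NormedSpace.Core ℝ (LipFun X) where
  norm_nonneg f := add_nonneg (supNorm_nonneg f) (lipConst_nonneg f)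
  norm_smul c f := by
    have h1 : (c • f).supNorm = |c| * f.supNorm := by
      rw [supNorm, supNorm, Real.mul_iSup_of_nonneg (abs_nonneg c)]
      exact congrArg iSup (funext fun x => by rw [smul_apply, abs_mul])
    have h2 : (c • f).lipConst = |c| * f.lipConst := by
      rw [lipConst, lipConst, Real.mul_iSup_of_nonneg (abs_nonneg c)]
      exact congrArg iSup (funext fun p => by
        rw [smul_apply, smul_apply, ← mul_sub, abs_mul, mul_div_assoc])
    rw [norm_def, norm_def, h1, h2, Real.norm_eq_abs, mul_add]
  norm_triangle f g := by
    have h1 : (f + g).supNorm ≤ f.supNorm + g.supNorm :=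
      supNorm_le (add_nonneg (supNorm_nonneg _) (supNorm_nonneg _)) fun x =>
        (abs_add_le _ _).trans (add_le_add (f.abs_le_supNorm x) (g.abs_le_supNorm x))
    have h2 : (f + g).lipConst ≤ f.lipConst + g.lipConst :=
      lipConst_le (add_nonneg (lipConst_nonneg _) (lipConst_nonneg _)) fun x y => by
        have e : (f + g) x - (f + g) y = (f x - f y) + (g x - g y) := by
          rw [add_apply, add_apply]; ring
        rw [e, add_mul]
        exact (abs_add_le _ _).trans (add_le_add (f.abs_sub_le x y) (g.abs_sub_le x y))
    rw [norm_def, norm_def, norm_def]; linarith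
  norm_eq_zero_iff f := by
    refine ⟨fun hf => ext fun x => ?_, ?_⟩
    · rw [norm_def] at hf
      have h1 := f.abs_le_supNorm x
      have h2 := f.lipConst_nonneg
      exact abs_eq_zero.1 (le_antisymm (by linarith) (abs_nonneg _))
    · rintro rfl
      have h1 : (0 : LipFun X).supNorm ≤ 0 := supNorm_le le_rfl fun x => by simp [zero_apply]
      have h2 : (0 : LipFun X).lipConst ≤ 0 :=
        lipConst_le le_rfl fun x y => by simp [zero_apply]
      exact le_antisymm (by rw [norm_def]; linarith)
        (add_nonneg (supNorm_nonneg _) (lipConst_nonneg _))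

/-- For compact `X`, the Lipschitz norm makes `Lip(X)` a normed space. -/
instance : NormedAddCommGroup (LipFun X) := NormedAddCommGroup.ofCore normCore

instance : NormedSpace ℝ (LipFun X) := NormedSpace.ofCore normCore

/-- `Lip(X)` is a Banach space. -/
instance : CompleteSpace (LipFun X) := by
  refine Metric.complete_of_cauchySeq_tendsto fun u hu => ?_
  have hsup : ∀ f : LipFun X, f.supNorm ≤ ‖f‖ := fun f => by
    have h1 := f.norm_def
    have h2 := f.lipConst_nonneg
    linarith
  have hlip : ∀ f : LipFun X, f.lipConst ≤ ‖f‖ := fun f => by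
    have h1 := f.norm_def
    have h2 := f.supNorm_nonneg
    linarith
  have hc : ∀ ε > 0, ∃ n₀, ∀ m ≥ n₀, ∀ n ≥ n₀, ‖u m - u n‖ < ε := fun ε hε => by
    obtain ⟨n₀, h⟩ := Metric.cauchySeq_iff.1 hu ε hε
    exact ⟨n₀, fun m hm n hn => by rw [← dist_eq_norm]; exact h m hm n hn⟩
  have hpt : ∀ x, ∃ l, Tendsto (fun n => u n x) atTop (𝓝 l) := fun x => by
    refine cauchySeq_tendsto_of_complete (Metric.cauchySeq_iff.2 fun ε hε => ?_)
    obtain ⟨n₀, h⟩ := hc ε hε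
    refine ⟨n₀, fun m hm n hn => ?_⟩
    rw [Real.dist_eq, ← sub_apply]
    exact (((u m - u n).abs_le_supNorm x).trans (hsup _)).trans_lt (h m hm n hn)
  choose g hg using hpt
  have key : ∀ ε > 0, ∃ n₀, ∀ m ≥ n₀, (∀ x, |u m x - g x| ≤ ε) ∧
      ∀ x y, |(u m x - g x) - (u m y - g y)| ≤ ε * dist x y := fun ε hε => by
    obtain ⟨n₀, h⟩ := hc ε hε
    refine ⟨n₀, fun m hm => ⟨fun x => ?_, fun x y => ?_⟩⟩
    · refine le_of_tendsto ((tendsto_const_nhds.sub (hg x)).abs) ?_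
      filter_upwards [eventually_ge_atTop n₀] with n hn
      rw [← sub_apply]
      exact (((u m - u n).abs_le_supNorm x).trans (hsup _)).trans (h m hm n hn).le
    · refine le_of_tendsto (((tendsto_const_nhds.sub (hg x)).sub
        (tendsto_const_nhds.sub (hg y))).abs) ?_
      filter_upwards [eventually_ge_atTop n₀] with n hn
      rw [← sub_apply, ← sub_apply]
      exact ((u m - u n).abs_sub_le x y).trans (mul_le_mul_of_nonneg_right
        ((hlip _).trans (h m hm n hn).le) dist_nonneg)
  have hgL : ∃ K : NNReal, LipschitzWith K g := by
    obtain ⟨n₀, h⟩ := key 1 one_pos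
    obtain ⟨K, hK⟩ := (u n₀).2
    refine ⟨K + 1, LipschitzWith.of_dist_le_mul fun x y => ?_⟩
    have h1 := (h n₀ le_rfl).2 x y
    have h2 := hK.dist_le_mul x y
    rw [Real.dist_eq] at h2 ⊢
    have e : g x - g y = ((u n₀) x - (u n₀) y) - (((u n₀) x - g x) - ((u n₀) y - g y)) := by ring
    rw [e, NNReal.coe_add, NNReal.coe_one, add_mul]
    exact (abs_sub _ _).trans (add_le_add h2 h1)
  obtain ⟨G, hG⟩ : ∃ G : LipFun X, ∀ x, G x = g x := ⟨⟨g, hgL⟩, fun _ => rfl⟩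
  refine ⟨G, Metric.tendsto_atTop.2 fun ε hε => ?_⟩
  obtain ⟨n₀, h⟩ := key (ε / 3) (by positivity)
  refine ⟨n₀, fun n hn => ?_⟩
  have h1 : (u n - G).supNorm ≤ ε / 3 :=
    supNorm_le (by positivity) fun x => by rw [sub_apply, hG]; exact (h n hn).1 x
  have h2 : (u n - G).lipConst ≤ ε / 3 :=
    lipConst_le (by positivity) fun x y => by
      rw [sub_apply, sub_apply, hG, hG]; exact (h n hn).2 x y
  rw [dist_eq_norm, norm_def]
  linarith

/-- `Lip(X)` carries the Borel σ-algebra of the norm topology. -/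
instance : MeasurableSpace (LipFun X) := borel (LipFun X)

instance : BorelSpace (LipFun X) := ⟨rfl⟩

end LipFun

/-- Prevalence (Hunt, Sauer, Yorke) of a subset `S` of a complete linear metric space `V`: `S`
contains a Borel set `B` for which there is a Borel measure `ν` on `V`, positive and finite on
some compact set, such that for every `v`, `v + e ∈ B` for `ν`-almost every `e`. -/
def IsPrevalent {V : Type*} [AddCommGroup V] [Module ℝ V] [MetricSpace V] [CompleteSpace V]
    [IsTopologicalAddGroup V] [ContinuousSMul ℝ V] [MeasurableSpace V] [BorelSpace V]
    (S : Set V) : Prop :=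
  ∃ B ⊆ S, MeasurableSet B ∧ ∃ ν : Measure V,
    (∃ K : Set V, IsCompact K ∧ 0 < ν K ∧ ν K < ⊤) ∧ ∀ v : V, ∀ᵐ e ∂ν, v + e ∈ B

/-- The quotient `log μ(B(x, δ)) / log δ`, with `log 0 = -∞`. -/
def localDimRatio {Y : Type*} [MetricSpace Y] [MeasurableSpace Y] (μ : Measure Y) (x : Y)
    (δ : ℝ) : EReal :=
  ENNReal.log (μ (Metric.ball x δ)) / ((Real.log δ : ℝ) : EReal)

/-- The lower local dimension of `μ` at `x`. -/
def lowerLocalDim {Y : Type*} [MetricSpace Y] [MeasurableSpace Y] (μ : Measure Y) (x : Y) :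
    EReal :=
  liminf (localDimRatio μ x) (𝓝[>] 0)

/-- The upper local dimension of `μ` at `x`. -/
def upperLocalDim {Y : Type*} [MetricSpace Y] [MeasurableSpace Y] (μ : Measure Y) (x : Y) :
    EReal :=
  limsup (localDimRatio μ x) (𝓝[>] 0)

/-- The local dimension of `μ` at `x` exists and equals `d`. -/
def HasLocalDim {Y : Type*} [MetricSpace Y] [MeasurableSpace Y] (μ : Measure Y) (x : Y)
    (d : EReal) : Prop :=
  lowerLocalDim μ x = d ∧ upperLocalDim μ x = d

/-- The `k`-delay coordinate map `x ↦ (h x, h (T x), …, h (T^(k-1) x))` into Euclidean `ℝ^k`. -/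
def delayMap {X : Type*} (T : X → X) (k : ℕ) (h : X → ℝ) (x : X) : EuclideanSpace ℝ (Fin k) :=
  WithLp.toLp 2 fun i : Fin k => h (T^[(i : ℕ)] x)

end

/-! Upper bound, valid for every Lipschitz `h`: the delay map is Lipschitz, so local dimensions
cannot increase (`upperLocalDim_map_le`), and a finite measure on `ℝ^k` has upper local dimension at
most `k` almost everywhere (`ae_upperLocalDim_le`).

Lower bound: perturb an arbitrary `v` by a random series of cut-off coordinate functions with
independent uniform coefficients. The law of this series is the measure witnessing prevalence
(`isPrevalent_of_ae_uniformPi`). For almost every `x` the points `x, …, T^(k-1) x` are distinct, so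
`x` lies in a "tube" on which the `k` times see disjointly supported cut-offs. For `x, y` in one
tube, `k` separate coefficients then control the `k` delay differences, and the probability that all
of them are below `δ` is at most `∏ min(1, Cδ / |T^i x - T^i y|)`
(`exists_uniformPi_delay_close_le`).

If `μ {y | |T^i x - T^i y| < r} ≤ M r^s` for every `i` and `s < k`, integrating the product in `y`
gives `O(δ^s)` (`exists_lintegral_min_pow_le`). This decay at all times follows from decay at time
`0`, through invariance or through the bi-Lipschitz bound (`ae_exists_forall_mem_decaySet_iterate`).
Summing over dyadic `δ` with weights `δ^(-t)`, `t < s`, makes an energy finite almost surely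
(`ae_energySum_lt_top`), and finite energy forces lower local dimension at least `t` almost
everywhere (`ae_le_lowerLocalDim_of_energySum_lt_top`). The energy only sees `μ` restricted to a
tube; Besicovitch differentiation transfers the bound to the full push-forward
(`ae_le_lowerLocalDim_map`). Countably many rational exponents, constants and tubes suffice. -/

open MeasureTheory Filter Topology

noncomputable section

/-! ### Local dimensions and power bounds on the measure of balls -/

section LocalDim

variable {Y : Type*} [MetricSpace Y] [MeasurableSpace Y]

/-- Since `log δ < 0`, dividing by it reverses order. Comparisons of the dimension quotient with a
real `s` thus become comparisons of the ball measure with `δ ^ s`. -/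
theorem strictAnti_log_div {δ : ℝ} (h0 : 0 < δ) (h1 : δ < 1) :
    StrictAnti fun p : ENNReal => ENNReal.log p / ((Real.log δ : ℝ) : EReal) := fun _ _ h =>
  EReal.div_lt_div_right_of_neg (by exact_mod_cast Real.log_neg h0 h1) (EReal.coe_ne_bot _)
    (ENNReal.log_lt_log h)

theorem log_ofReal_rpow_div {δ : ℝ} (h0 : 0 < δ) (h1 : δ < 1) (s : ℝ) :
    ENNReal.log (ENNReal.ofReal (δ ^ s)) / ((Real.log δ : ℝ) : EReal) = s := by
  rw [ENNReal.log_ofReal_of_pos (Real.rpow_pos_of_pos h0 s), Real.log_rpow h0, ← EReal.coe_div,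
    mul_div_assoc, div_self (Real.log_neg h0 h1).ne, mul_one]

theorem coe_le_localDimRatio_iff {μ : Measure Y} {x : Y} {δ : ℝ} (h0 : 0 < δ) (h1 : δ < 1)
    (s : ℝ) : (s : EReal) ≤ localDimRatio μ x δ ↔
      μ (Metric.ball x δ) ≤ ENNReal.ofReal (δ ^ s) := by
  rw [← log_ofReal_rpow_div h0 h1 s, localDimRatio]
  exact (strictAnti_log_div h0 h1).le_iff_ge

theorem localDimRatio_le_coe_iff {μ : Measure Y} {x : Y} {δ : ℝ} (h0 : 0 < δ) (h1 : δ < 1)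
    (s : ℝ) : localDimRatio μ x δ ≤ (s : EReal) ↔
      ENNReal.ofReal (δ ^ s) ≤ μ (Metric.ball x δ) := by
  rw [← log_ofReal_rpow_div h0 h1 s, localDimRatio]
  exact (strictAnti_log_div h0 h1).le_iff_ge

theorem eventually_pos_lt_one : ∀ᶠ δ : ℝ in 𝓝[>] 0, 0 < δ ∧ δ < 1 :=
  Ioo_mem_nhdsGT one_pos

theorem tendsto_mul_nhdsGT_zero {c : ℝ} (hc : 0 < c) :
    Tendsto (fun r : ℝ => c * r) (𝓝[>] 0) (𝓝[>] 0) := by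
  refine tendsto_nhdsWithin_iff.2 ⟨?_, ?_⟩
  · have h : Tendsto (fun r : ℝ => c * r) (𝓝 0) (𝓝 (c * 0)) := tendsto_id.const_mul c
    rw [mul_zero] at h
    exact h.mono_left nhdsWithin_le_nhds
  · filter_upwards [self_mem_nhdsWithin] with r hr
    exact mul_pos hc hr

theorem eventually_measure_ball_le {μ : Measure Y} {x : Y} {s : ℝ}
    (h : (s : EReal) < lowerLocalDim μ x) :
    ∀ᶠ δ in 𝓝[>] (0 : ℝ), μ (Metric.ball x δ) ≤ ENNReal.ofReal (δ ^ s) := by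
  filter_upwards [eventually_lt_of_lt_liminf h, eventually_pos_lt_one] with δ h1 h2
  exact (coe_le_localDimRatio_iff h2.1 h2.2 s).1 h1.le

theorem eventually_le_measure_ball {μ : Measure Y} {x : Y} {s : ℝ}
    (h : upperLocalDim μ x < (s : EReal)) :
    ∀ᶠ δ in 𝓝[>] (0 : ℝ), ENNReal.ofReal (δ ^ s) ≤ μ (Metric.ball x δ) := by
  filter_upwards [eventually_lt_of_limsup_lt h, eventually_pos_lt_one] with δ h1 h2
  exact (localDimRatio_le_coe_iff h2.1 h2.2 s).1 h1.le

/-- A finite constant is absorbed by any loss in the exponent, because `δ ^ (s - t) → 0`. Hence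
constants do not affect local dimensions. -/
theorem eventually_mul_rpow_le {C : ENNReal} (hC : C ≠ ⊤) {s t : ℝ} (hts : t < s) :
    ∀ᶠ δ in 𝓝[>] (0 : ℝ), C * ENNReal.ofReal (δ ^ s) ≤ ENNReal.ofReal (δ ^ t) := by
  have h : Tendsto (fun δ : ℝ => C.toReal * δ ^ (s - t)) (𝓝[>] 0) (𝓝 0) := by
    have h1 : ContinuousAt (fun δ : ℝ => C.toReal * δ ^ (s - t)) 0 :=
      continuousAt_const.mul (Real.continuousAt_rpow_const _ _ (Or.inr (sub_pos.2 hts).le))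
    have h2 := h1.tendsto
    simp only [Real.zero_rpow (sub_pos.2 hts).ne', mul_zero] at h2
    exact h2.mono_left nhdsWithin_le_nhds
  filter_upwards [h.eventually (ge_mem_nhds one_pos), eventually_pos_lt_one] with δ h1 h2
  rw [← ENNReal.ofReal_toReal hC, ← ENNReal.ofReal_mul ENNReal.toReal_nonneg]
  refine ENNReal.ofReal_le_ofReal ?_
  have e : δ ^ s = δ ^ (s - t) * δ ^ t := by rw [← Real.rpow_add h2.1]; congr 1; ring
  rw [e, ← mul_assoc]
  exact mul_le_of_le_one_left (Real.rpow_nonneg h2.1.le _) h1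

theorem le_lowerLocalDim {μ : Measure Y} {x : Y} {s : ℝ} {C : ENNReal} (hC : C ≠ ⊤)
    (h : ∀ᶠ δ in 𝓝[>] (0 : ℝ), μ (Metric.ball x δ) ≤ C * ENNReal.ofReal (δ ^ s)) :
    (s : EReal) ≤ lowerLocalDim μ x := by
  refine EReal.ge_of_forall_gt_iff_ge.1 fun t ht => ?_
  refine le_liminf_of_le (by isBoundedDefault) ?_
  filter_upwards [h, eventually_mul_rpow_le hC (EReal.coe_lt_coe_iff.1 ht),
    eventually_pos_lt_one] with δ h1 h2 h3
  exact (coe_le_localDimRatio_iff h3.1 h3.2 t).2 (h1.trans h2)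

theorem upperLocalDim_le {μ : Measure Y} {x : Y} {s : ℝ} {C : ENNReal} (hC : C ≠ ⊤)
    (h : ∀ᶠ δ in 𝓝[>] (0 : ℝ), ENNReal.ofReal (δ ^ s) ≤ C * μ (Metric.ball x δ)) :
    upperLocalDim μ x ≤ s := by
  refine EReal.le_of_forall_lt_iff_le.1 fun t ht => ?_
  refine limsup_le_of_le (by isBoundedDefault) ?_
  have hC' : C + 1 ≠ ⊤ := ENNReal.add_ne_top.2 ⟨hC, ENNReal.one_ne_top⟩
  filter_upwards [h, eventually_mul_rpow_le hC' (EReal.coe_lt_coe_iff.1 ht),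
    eventually_pos_lt_one] with δ h1 h2 h3
  rw [localDimRatio_le_coe_iff h3.1 h3.2 t]
  refine (ENNReal.mul_le_mul_iff_right (by simp : C + 1 ≠ 0) hC').1 ?_
  exact h2.trans (h1.trans (mul_le_mul_left le_self_add _))

theorem lowerLocalDim_le_upperLocalDim (μ : Measure Y) (x : Y) :
    lowerLocalDim μ x ≤ upperLocalDim μ x := liminf_le_limsup

theorem zero_le_lowerLocalDim (μ : Measure Y) [IsFiniteMeasure μ] (x : Y) :
    0 ≤ lowerLocalDim μ x := by
  have h : ((0 : ℝ) : EReal) ≤ lowerLocalDim μ x :=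
    le_lowerLocalDim (measure_ne_top μ Set.univ) <| Eventually.of_forall fun δ => by
      simpa using measure_mono (Set.subset_univ _)
  exact_mod_cast h

end LocalDim

/-! ### Differentiation of measures on Euclidean space -/

section Euclidean

variable {k : ℕ}

/-- By Besicovitch, the ratio of ball measures converges `m`-almost everywhere to the Radon–Nikodym
derivative, which is finite there; `C` is this limit plus one. No absolute continuity is needed. -/
theorem ae_eventually_closedBall_le (ρ m : Measure (EuclideanSpace ℝ (Fin k)))
    [IsLocallyFiniteMeasure ρ] [IsFiniteMeasure m] :
    ∀ᵐ z ∂m, ∃ C : ENNReal, C ≠ ⊤ ∧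
      ∀ᶠ r in 𝓝[>] (0 : ℝ), ρ (Metric.closedBall z r) ≤ C * m (Metric.closedBall z r) := by
  filter_upwards [Besicovitch.ae_tendsto_rnDeriv ρ m, Measure.rnDeriv_lt_top ρ m] with z h1 h2
  have h3 : ρ.rnDeriv m z + 1 ≠ ⊤ := ENNReal.add_ne_top.2 ⟨h2.ne, ENNReal.one_ne_top⟩
  refine ⟨_, h3, ?_⟩
  filter_upwards [h1.eventually (ge_mem_nhds (ENNReal.lt_add_right h2.ne one_ne_zero))] with r hr
  exact (ENNReal.div_le_iff_le_mul (Or.inr h3) (Or.inl (measure_ne_top _ _))).1 hr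

/-- The upper local dimension of a finite measure on `ℝ^k` is at most `k` almost everywhere. -/
theorem ae_upperLocalDim_le (m : Measure (EuclideanSpace ℝ (Fin k))) [IsFiniteMeasure m] :
    ∀ᵐ z ∂m, upperLocalDim m z ≤ (k : EReal) := by
  filter_upwards [ae_eventually_closedBall_le volume m] with z ⟨C, hC, h⟩
  set c : ENNReal := volume (Metric.ball (0 : EuclideanSpace ℝ (Fin k)) 1)
  have hc0 : c ≠ 0 := (Metric.measure_ball_pos _ _ one_pos).ne'
  have h2 : ∀ᶠ r in 𝓝[>] (0 : ℝ), ENNReal.ofReal (r ^ (k : ℝ)) ≤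
      (c⁻¹ * ENNReal.ofReal (2 ^ k) * C) * m (Metric.ball z r) := by
    -- The radius is halved because differentiation uses closed balls and local dimension open ones.
    filter_upwards [(tendsto_mul_nhdsGT_zero (half_pos one_pos)).eventually h,
      self_mem_nhdsWithin] with r h1 hr
    have hr : 0 < r := hr
    rw [one_div_mul_eq_div] at h1
    have h3 : volume (Metric.closedBall z (r / 2)) = ENNReal.ofReal ((r / 2) ^ k) * c := by
      rw [Measure.addHaar_closedBall _ _ (half_pos hr).le, finrank_euclideanSpace_fin]
    have h4 : m (Metric.closedBall z (r / 2)) ≤ m (Metric.ball z r) :=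
      measure_mono (Metric.closedBall_subset_ball (half_lt_self hr))
    calc ENNReal.ofReal (r ^ (k : ℝ))
        = c⁻¹ * ENNReal.ofReal (2 ^ k) * (ENNReal.ofReal ((r / 2) ^ k) * c) := by
          have e : r ^ (k : ℝ) = 2 ^ k * (r / 2) ^ k := by
            rw [Real.rpow_natCast, ← mul_pow]; congr 1; ring
          rw [e, ENNReal.ofReal_mul (by positivity)]
          calc _ = (c⁻¹ * c) * (ENNReal.ofReal (2 ^ k) * ENNReal.ofReal ((r / 2) ^ k)) := by
                rw [ENNReal.inv_mul_cancel hc0 measure_ball_lt_top.ne, one_mul]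
            _ = _ := by ring
      _ ≤ c⁻¹ * ENNReal.ofReal (2 ^ k) * (C * m (Metric.ball z r)) := by
          rw [← h3]; gcongr; exact h1.trans (by gcongr)
      _ = _ := by ring
  exact upperLocalDim_le (ENNReal.mul_ne_top (ENNReal.mul_ne_top (ENNReal.inv_ne_top.2 hc0)
    ENNReal.ofReal_ne_top) hC) h2

end Euclidean

/-! ### Local dimensions of push-forwards -/

theorem upperLocalDim_map_le {X Y : Type*} [MetricSpace X] [MeasurableSpace X] [BorelSpace X]
    [MetricSpace Y] [MeasurableSpace Y] [BorelSpace Y] (μ : Measure X) {f : X → Y} {K : NNReal}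
    (hf : LipschitzWith K f) (x : X) : upperLocalDim (μ.map f) (f x) ≤ upperLocalDim μ x := by
  refine EReal.le_of_forall_lt_iff_le.1 fun t ht => ?_
  -- Adding one keeps the constant invertible when `K = 0`.
  set L : ℝ := K + 1
  have hL0 : 0 < L := by positivity
  have hC : ENNReal.ofReal (L ^ t) ≠ ⊤ := ENNReal.ofReal_ne_top
  refine upperLocalDim_le hC ?_
  filter_upwards [(tendsto_mul_nhdsGT_zero (inv_pos.2 hL0)).eventually
    (eventually_le_measure_ball ht), self_mem_nhdsWithin] with δ h1 hδ
  have hδ : 0 < δ := hδ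
  have h2 : Metric.ball x (L⁻¹ * δ) ⊆ f ⁻¹' Metric.ball (f x) δ := fun y hy => by
    have h3 : dist y x < L⁻¹ * δ := hy
    have h4 : L * dist y x < δ := by rwa [← lt_inv_mul_iff₀ hL0]
    refine lt_of_le_of_lt (hf.dist_le_mul y x) (lt_of_le_of_lt ?_ h4)
    exact mul_le_mul_of_nonneg_right (by linarith) dist_nonneg
  have h5 : δ ^ t = L ^ t * (L⁻¹ * δ) ^ t := by
    rw [← Real.mul_rpow hL0.le (by positivity), mul_inv_cancel_left₀ hL0.ne']
  rw [Measure.map_apply hf.continuous.measurable Metric.isOpen_ball.measurableSet, h5,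
    ENNReal.ofReal_mul (by positivity)]
  gcongr
  exact h1.trans (measure_mono h2)

/-- This localizes the lower bound: differentiating the push-forward of `μ` against that of
`μ.restrict U` bounds small balls of the former by those of the latter, at almost every point of
`U`. -/
theorem ae_le_lowerLocalDim_map {X : Type*} [MeasurableSpace X] (μ : Measure X)
    [IsFiniteMeasure μ] {k : ℕ} {f : X → EuclideanSpace ℝ (Fin k)} (hf : Measurable f)
    (U : Set X) : ∀ᵐ x ∂μ.restrict U, ∀ t : ℝ, ∀ C : ENNReal, C ≠ ⊤ →
      (∀ᶠ δ in 𝓝[>] (0 : ℝ),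
        μ.restrict U (f ⁻¹' Metric.ball (f x) δ) ≤ C * ENNReal.ofReal (δ ^ t)) →
      (t : EReal) ≤ lowerLocalDim (μ.map f) (f x) := by
  filter_upwards [ae_of_ae_map hf.aemeasurable
    (ae_eventually_closedBall_le (μ.map f) ((μ.restrict U).map f))] with x ⟨D, hD, h1⟩ t C hC h2
  have hE : D * (C * ENNReal.ofReal (2 ^ t)) ≠ ⊤ :=
    ENNReal.mul_ne_top hD (ENNReal.mul_ne_top hC ENNReal.ofReal_ne_top)
  refine le_lowerLocalDim hE ?_
  filter_upwards [h1, (tendsto_mul_nhdsGT_zero two_pos).eventually h2, self_mem_nhdsWithin]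
    with δ h3 h4 hδ
  have hδ : 0 < δ := hδ
  calc μ.map f (Metric.ball (f x) δ)
      ≤ D * (μ.restrict U).map f (Metric.closedBall (f x) δ) :=
        (measure_mono Metric.ball_subset_closedBall).trans h3
    _ ≤ D * (μ.restrict U).map f (Metric.ball (f x) (2 * δ)) := by
        gcongr; exact Metric.closedBall_subset_ball (by linarith)
    _ ≤ D * (C * ENNReal.ofReal ((2 * δ) ^ t)) := by
        rw [Measure.map_apply hf Metric.isOpen_ball.measurableSet]; gcongr
    _ = _ := by
        rw [Real.mul_rpow two_pos.le hδ.le, ENNReal.ofReal_mul (by positivity)]; ring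

/-! ### Independent uniform coefficients and resampling -/

section Resample

variable {ι : Type*} [DecidableEq ι]

/-- The law of a family of independent uniform random variables on `[0, 1]`. -/
abbrev uniformPi (ι : Type*) : Measure (ι → unitInterval) :=
  Measure.infinitePi fun _ => (volume : Measure unitInterval)

theorem measurable_update_uncurry (n : ι) :
    Measurable fun p : (ι → unitInterval) × unitInterval => Function.update p.1 n p.2 := by
  refine measurable_pi_iff.2 fun i => ?_
  by_cases h : i = n
  · subst h; simpa using measurable_snd
  · simpa [h, Function.comp_def] using (measurable_pi_apply i).comp measurable_fst

/-- Resampling one coordinate does not change the law. -/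
theorem map_update_uniformPi (n : ι) :
    ((uniformPi ι).prod volume).map (fun p => Function.update p.1 n p.2) = uniformPi ι := by
  refine Measure.eq_infinitePi _ fun s t ht => ?_
  rw [Measure.map_apply (measurable_update_uncurry n)
    (MeasurableSet.pi s.countable_toSet fun i _ => ht i)]
  -- The preimage of a box is again a box: the constraint at `n` moves to the new variable.
  have e : (fun p : (ι → unitInterval) × unitInterval => Function.update p.1 n p.2) ⁻¹'
      (s : Set ι).pi t = ((s.erase n : Finset ι) : Set ι).pi t ×ˢ
        (if n ∈ s then t n else Set.univ) := by
    ext ⟨a, b⟩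
    simp only [Set.mem_preimage, Set.mem_pi, Set.mem_prod, Finset.coe_erase, Set.mem_sdiff,
      Finset.mem_coe, Set.mem_singleton_iff]
    constructor
    · refine fun h => ⟨fun i hi => by simpa [hi.2] using h i hi.1, ?_⟩
      split_ifs with hn
      · simpa using h n hn
      · trivial
    · rintro ⟨h1, h2⟩ i hi
      by_cases hin : i = n
      · subst hin; simpa [hi] using h2
      · simpa [hin] using h1 i ⟨hi, hin⟩
  rw [e, Measure.prod_prod, Measure.infinitePi_pi _ fun i _ => ht i]
  split_ifs with hn
  · rw [mul_comm, Finset.mul_prod_erase s (fun i => volume (t i)) hn]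
  · rw [Finset.erase_eq_of_notMem hn, measure_univ, mul_one]

theorem uniformPi_eq_lintegral_update (n : ι) {E : Set (ι → unitInterval)}
    (hE : MeasurableSet E) :
    uniformPi ι E = ∫⁻ a, volume {t | Function.update a n t ∈ E} ∂uniformPi ι := by
  conv_lhs => rw [← map_update_uniformPi n]
  rw [Measure.map_apply (measurable_update_uncurry n) hE,
    Measure.prod_apply (measurable_update_uncurry n hE)]
  rfl

/-- An affine function of slope `a` is below `δ` in absolute value only on an interval of length `2δ
/ |a|`. -/
theorem volume_abs_affine_lt_le {f : unitInterval → ℝ} {a δ : ℝ}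
    (hf : ∀ s t, f s - f t = ((s : ℝ) - t) * a) :
    volume {t | |f t| < δ} ≤ min 1 (ENNReal.ofReal (2 * δ) / ENNReal.ofReal |a|) := by
  refine le_min prob_le_one ?_
  -- For zero slope and `δ > 0` the quotient is `⊤`, so the bound is `1`; for `δ ≤ 0` the set is
  -- empty.
  by_cases ha : a = 0
  · by_cases hδ : 0 < δ
    · subst ha
      simp [ENNReal.div_zero, hδ]
    · have : {t | |f t| < δ} = ∅ := Set.eq_empty_of_forall_notMem fun t ht =>
        hδ ((abs_nonneg _).trans_lt ht)
      rw [this, measure_empty]; exact zero_le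
  have ha' : 0 < |a| := abs_pos.2 ha
  rw [← ENNReal.ofReal_div_of_pos ha']
  set c : ℝ := -(f 0) / a
  have hsub : (Subtype.val '' {t : unitInterval | |f t| < δ}) ⊆
      Metric.ball c (δ / |a|) := by
    rintro _ ⟨t, ht, rfl⟩
    have h1 := hf t 0
    have h2 : (t : ℝ) - c = f t / a := by
      simp only [c, Set.Icc.coe_zero, sub_zero] at h1 ⊢
      field_simp; linarith
    rw [Metric.mem_ball, Real.dist_eq, h2, abs_div]
    exact div_lt_div_of_pos_right ht ha'
  calc volume {t | |f t| < δ}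
      = (volume : Measure ℝ) (Subtype.val '' {t : unitInterval | |f t| < δ}) :=
        comap_subtype_coe_apply measurableSet_Icc volume _
    _ ≤ volume (Metric.ball c (δ / |a|)) := measure_mono hsub
    _ = _ := by rw [Real.volume_ball, mul_div_assoc]

/-- Induction on the set of constraints: resampling `n j` leaves the earlier constraints unchanged
by `ho`, while the `j`-th becomes affine with slope `a j` and contributes one factor. Independence
of the `Z i` themselves is not required. -/
theorem uniformPi_forall_abs_lt_le {k : ℕ} {n : Fin k → ι}
    {Z : Fin k → (ι → unitInterval) → ℝ} (hZ : ∀ i, Measurable (Z i)) {a : Fin k → ℝ} {δ : ℝ}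
    (hd : ∀ i α s t, Z i (Function.update α (n i) s) - Z i (Function.update α (n i) t) =
      ((s : ℝ) - t) * a i)
    (ho : ∀ i j, i ≠ j → ∀ α t, Z i (Function.update α (n j) t) = Z i α) :
    uniformPi ι {α | ∀ i, |Z i α| < δ} ≤
      ∏ i, min 1 (ENNReal.ofReal (2 * δ) / ENNReal.ofReal |a i|) := by
  have key : ∀ S : Finset (Fin k), uniformPi ι {α | ∀ i ∈ S, |Z i α| < δ} ≤
      ∏ i ∈ S, min 1 (ENNReal.ofReal (2 * δ) / ENNReal.ofReal |a i|) := by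
    intro S
    have hm : ∀ S : Finset (Fin k), MeasurableSet {α | ∀ i ∈ S, |Z i α| < δ} := fun S => by
      have : {α | ∀ i ∈ S, |Z i α| < δ} = ⋂ i ∈ S, {α | |Z i α| < δ} := by ext; simp
      rw [this]
      exact S.measurableSet_biInter fun i _ =>
        measurableSet_lt (continuous_abs.measurable.comp (hZ i)) measurable_const
    induction S using Finset.induction_on with
    | empty => simp
    | insert j S hj ih =>
      rw [Finset.prod_insert hj, uniformPi_eq_lintegral_update (n j) (hm _)]
      set b := min 1 (ENNReal.ofReal (2 * δ) / ENNReal.ofReal |a j|)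
      set E := {α | ∀ i ∈ S, |Z i α| < δ}
      calc _ ≤ ∫⁻ α, E.indicator (fun _ => b) α ∂uniformPi ι := by
            refine lintegral_mono fun α => ?_
            by_cases hα : α ∈ E
            · rw [Set.indicator_of_mem hα]
              refine le_trans (measure_mono fun t ht => ?_)
                (volume_abs_affine_lt_le (f := fun t => Z j (Function.update α (n j) t))
                  (hd j α))
              exact ht j (Finset.mem_insert_self j S)
            · rw [Set.indicator_of_notMem hα, nonpos_iff_eq_zero]
              convert measure_empty (μ := (volume : Measure unitInterval))
              refine Set.eq_empty_of_forall_notMem fun t ht => hα fun i hi => ?_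
              have h1 := ht i (Finset.mem_insert_of_mem hi)
              rwa [ho i j (fun h => hj (h ▸ hi))] at h1
        _ = b * uniformPi ι E := lintegral_indicator_const (hm S) b
        _ ≤ _ := by gcongr
  simpa using key Finset.univ

end Resample

/-! ### Random series in a Banach space -/

section Series

variable {ι V : Type*} [NormedAddCommGroup V] [NormedSpace ℝ V]

/-- The series `∑ α i • u i`. -/
def unitSeries (u : ι → V) (α : ι → unitInterval) : V := ∑' i, (α i : ℝ) • u i

theorem norm_unitInterval_smul_le (t : unitInterval) (v : V) : ‖(t : ℝ) • v‖ ≤ ‖v‖ := by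
  rw [norm_smul, Real.norm_of_nonneg t.2.1]
  exact mul_le_of_le_one_left (norm_nonneg v) t.2.2

variable [CompleteSpace V] {u : ι → V}

theorem continuous_unitSeries (hu : Summable fun i => ‖u i‖) : Continuous (unitSeries u) :=
  continuous_tsum (fun i => ((continuous_subtype_val.comp (continuous_apply i)).smul
    continuous_const)) hu fun i α => norm_unitInterval_smul_le (α i) (u i)

theorem unitSeries_update_sub [DecidableEq ι] (hu : Summable fun i => ‖u i‖)
    (α : ι → unitInterval) (n : ι) (s t : unitInterval) :
    unitSeries u (Function.update α n s) - unitSeries u (Function.update α n t) =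
      ((s : ℝ) - t) • u n := by
  have hs : ∀ α : ι → unitInterval, Summable fun i => (α i : ℝ) • u i := fun α =>
    Summable.of_norm_bounded hu fun i => norm_unitInterval_smul_le (α i) (u i)
  rw [unitSeries, unitSeries, ← (hs _).tsum_sub (hs _), tsum_eq_single n]
  · simp [sub_smul]
  · intro i hi; simp [hi]

end Series

/-- Evaluation is continuous in the point and `1`-Lipschitz in the function, as the norm dominates
the supremum. The measurability statements below rest on this. -/
theorem LipFun.continuous_uncurry {X : Type*} [MetricSpace X] [CompactSpace X] :
    Continuous fun p : LipFun X × X => p.1 p.2 := by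
  refine continuous_prod_of_continuous_lipschitzWith _ 1 (fun h => ?_) fun x =>
    LipschitzWith.of_dist_le_mul fun f g => ?_
  · obtain ⟨K, hK⟩ := h.2
    exact hK.continuous
  · rw [Real.dist_eq, ← LipFun.sub_apply, dist_eq_norm, NNReal.coe_one, one_mul,
      LipFun.norm_def (f - g)]
    exact ((f - g).abs_le_supNorm x).trans (le_add_of_nonneg_right (f - g).lipConst_nonneg)

/-! ### Cut-off coordinate functions -/

section Cutoff

variable {N : ℕ}

/-- The `c`-th coordinate relative to `q`, cut off outside the ball of radius `2 * r`. -/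
def cutoffCoord (q : EuclideanSpace ℝ (Fin N)) (r : ℝ) (c : Fin N)
    (z : EuclideanSpace ℝ (Fin N)) : ℝ :=
  max (-max 0 (2 * r - dist z q)) (min (max 0 (2 * r - dist z q)) (z c - q c))

theorem EuclideanSpace.abs_apply_le (z : EuclideanSpace ℝ (Fin N)) (c : Fin N) :
    |z c| ≤ ‖z‖ := PiLp.norm_apply_le z c

theorem EuclideanSpace.exists_norm_le_mul_abs [NeZero N] (z : EuclideanSpace ℝ (Fin N)) :
    ∃ c, ‖z‖ ≤ N * |z c| := by
  obtain ⟨c, -, hc⟩ := Finset.exists_max_image Finset.univ (fun c => |z c|) Finset.univ_nonempty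
  refine ⟨c, le_of_sq_le_sq ?_ (by positivity)⟩
  have hN : (1 : ℝ) ≤ N := by exact_mod_cast NeZero.one_le
  rw [EuclideanSpace.norm_sq_eq]
  calc ∑ i, ‖z i‖ ^ 2 ≤ ∑ _i : Fin N, |z c| ^ 2 := Finset.sum_le_sum fun i hi =>
        pow_le_pow_left₀ (norm_nonneg _) (hc i hi) 2
    _ = N * |z c| ^ 2 := by simp
    _ ≤ N ^ 2 * |z c| ^ 2 := by gcongr; nlinarith
    _ = _ := by ring

theorem exists_lipschitzWith_cutoffCoord (q : EuclideanSpace ℝ (Fin N)) (r : ℝ) (c : Fin N) :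
    ∃ K, LipschitzWith K (cutoffCoord q r c) := by
  have h1 : LipschitzWith 1 fun z : EuclideanSpace ℝ (Fin N) => z c - q c :=
    LipschitzWith.of_dist_le_mul fun x y => by
      rw [Real.dist_eq, NNReal.coe_one, one_mul, dist_eq_norm, sub_sub_sub_cancel_right]
      exact EuclideanSpace.abs_apply_le (x - y) c
  have h2 : LipschitzWith (0 + 1) fun z => 2 * r - dist z q :=
    (LipschitzWith.const (2 * r)).sub (LipschitzWith.dist_left q)
  have h3 := (LipschitzWith.const (α := EuclideanSpace ℝ (Fin N)) (0 : ℝ)).max h2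
  exact ⟨_, h3.neg.max (h3.min h1)⟩

theorem cutoffCoord_of_lt {q z : EuclideanSpace ℝ (Fin N)} {r : ℝ} (h : dist z q < r)
    (c : Fin N) : cutoffCoord q r c z = z c - q c := by
  have h1 : |z c - q c| ≤ dist z q := by
    rw [dist_eq_norm]; exact EuclideanSpace.abs_apply_le (z - q) c
  have h2 := abs_le.1 (h1.trans (by linarith : dist z q ≤ 2 * r - dist z q))
  have h3 : dist z q ≤ max 0 (2 * r - dist z q) := le_max_of_le_right (by linarith)
  rw [cutoffCoord, min_eq_right (h2.2.trans (le_max_right _ _)), max_eq_right]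
  exact (abs_le.1 (h1.trans h3)).1

theorem cutoffCoord_of_le {q z : EuclideanSpace ℝ (Fin N)} {r : ℝ} (h : 2 * r ≤ dist z q)
    (c : Fin N) : cutoffCoord q r c z = 0 := by
  rw [cutoffCoord, max_eq_left (by linarith : 2 * r - dist z q ≤ 0)]
  simp

end Cutoff

/-! ### Probe functions, tubes and the transversality estimate -/

section Probe

variable {N : ℕ} (X : Set (EuclideanSpace ℝ (Fin N)))

/-- The centre with index `n` in a fixed dense sequence of `ℝ^N`. -/
abbrev center (N n : ℕ) : EuclideanSpace ℝ (Fin N) := TopologicalSpace.denseSeq _ n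

/-- A countable family of cut-off coordinates, restricted to `X`. -/
def probe (i : ℕ × ℕ × Fin N) : LipFun X :=
  ⟨fun x => cutoffCoord (center N i.1) (1 / ((i.2.1 : ℝ) + 1)) i.2.2 x, by
    obtain ⟨K, hK⟩ := exists_lipschitzWith_cutoffCoord (center N i.1)
      (1 / ((i.2.1 : ℝ) + 1)) i.2.2
    exact ⟨K * 1, hK.comp (LipschitzWith.subtype_val X)⟩⟩

theorem exists_summable_weight {ι V : Type*} [Countable ι] [NormedAddCommGroup V]
    [NormedSpace ℝ V] (g : ι → V) :
    ∃ w : ι → ℝ, (∀ i, 0 < w i) ∧ Summable fun i => ‖w i • g i‖ := by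
  have := Encodable.ofCountable ι
  obtain ⟨ε, hε, c, hc, -⟩ := posSumOfEncodable one_pos ι
  refine ⟨fun i => ε i / (1 + ‖g i‖), fun i => div_pos (hε i) (by positivity),
    Summable.of_nonneg_of_le (fun i => norm_nonneg _) (fun i => ?_) hc.summable⟩
  have h1 : 0 < 1 + ‖g i‖ := by positivity
  rw [norm_smul, Real.norm_of_nonneg (div_nonneg (hε i).le h1.le), div_mul_eq_mul_div,
    div_le_iff₀ h1]
  exact mul_le_mul_of_nonneg_left (by linarith) (hε i).le

variable {X}

/-- The points whose orbit segment of length `k` stays close to the given centres. -/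
def tube (T : X → X) {k : ℕ} (q : Fin k → ℕ) (m : ℕ) : Set X :=
  {x | ∀ i : Fin k, dist (T^[i] x : EuclideanSpace ℝ (Fin N)) (center N (q i)) <
    1 / ((m : ℝ) + 1)}

/-- The centres are far apart relative to the radius `1 / (m + 1)`. -/
def SeparatedCenters (N : ℕ) {k : ℕ} (q : Fin k → ℕ) (m : ℕ) : Prop :=
  ∀ i j, i ≠ j → 3 * (1 / ((m : ℝ) + 1)) ≤ dist (center N (q i)) (center N (q j))

theorem isOpen_tube {T : X → X} (hT : Continuous T) {k : ℕ} (q : Fin k → ℕ) (m : ℕ) :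
    IsOpen (tube T q m) := by
  have e : tube T q m = ⋂ i : Fin k, {x | dist (T^[i] x : EuclideanSpace ℝ (Fin N))
    (center N (q i)) < 1 / ((m : ℝ) + 1)} := by ext; simp [tube]
  rw [e]
  exact isOpen_iInter_of_finite fun i => isOpen_lt
    ((continuous_subtype_val.comp (hT.iterate i)).dist continuous_const) continuous_const

theorem exists_mem_tube {T : X → X} {k : ℕ} {x : X}
    (hx : Function.Injective fun i : Fin k => T^[i] x) :
    ∃ (q : Fin k → ℕ) (m : ℕ), SeparatedCenters N q m ∧ x ∈ tube T q m := by
  obtain ⟨ρ, hρ, h⟩ : ∃ ρ > 0, ∀ i j : Fin k, i ≠ j → ρ ≤ dist (T^[i] x) (T^[j] x) := by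
    have h := (Set.finite_univ (α := Fin k × Fin k)).subset
      (Set.subset_univ {p : Fin k × Fin k | p.1 ≠ p.2})
    obtain ⟨ρ, hρ, h1⟩ : ∃ ρ > 0, ∀ p ∈ h.toFinset,
        ρ ≤ dist (T^[p.1] x) (T^[p.2] x) := by
      rcases h.toFinset.eq_empty_or_nonempty with he | hne
      · exact ⟨1, one_pos, fun p hp => absurd (he ▸ hp) (Finset.notMem_empty p)⟩
      · obtain ⟨p, hp, hmin⟩ := Finset.exists_min_image h.toFinset
          (fun p => dist (T^[p.1] x) (T^[p.2] x)) hne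
        exact ⟨_, dist_pos.2 fun e => (h.mem_toFinset.1 hp) (hx e), hmin⟩
    exact ⟨ρ, hρ, fun i j hij => h1 (i, j) (h.mem_toFinset.2 hij)⟩
  -- With radius `r < ρ / 5`, moving both orbit points to their centres costs `2r`, leaving distance
  -- at least `ρ - 2r ≥ 3r`.
  obtain ⟨m, hm⟩ := exists_nat_one_div_lt (by positivity : 0 < ρ / 5)
  have hm0 : 0 < 1 / ((m : ℝ) + 1) := by positivity
  have hq : ∀ i : Fin k, ∃ n, dist (T^[i] x : EuclideanSpace ℝ (Fin N)) (center N n) <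
      1 / ((m : ℝ) + 1) := fun i =>
    Metric.denseRange_iff.1 (TopologicalSpace.denseRange_denseSeq _) _ _ hm0
  choose q hq using hq
  refine ⟨q, m, fun i j hij => ?_, hq⟩
  have h1 := h i j hij
  rw [Subtype.dist_eq] at h1
  have h2 := dist_triangle4 (T^[i] x : EuclideanSpace ℝ (Fin N)) (center N (q i))
    (center N (q j)) (T^[j] x)
  have h3 := hq i
  have h4 := hq j
  rw [dist_comm] at h4
  linarith

theorem ofReal_div_ofReal_le {p a p' d : ℝ} (hp' : 0 < p') (hd : 0 ≤ d)
    (h : p * d ≤ p' * a) (hda : 0 < d → 0 < a) :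
    ENNReal.ofReal p / ENNReal.ofReal a ≤ ENNReal.ofReal p' / ENNReal.ofReal d := by
  rcases hd.eq_or_lt with rfl | hd
  · simp [ENNReal.div_zero, hp']
  · rw [← ENNReal.ofReal_div_of_pos hd, ← ENNReal.ofReal_div_of_pos (hda hd)]
    exact ENNReal.ofReal_le_ofReal ((div_le_div_iff₀ (hda hd) hd).2 h)

/-- For each time `i`, the coefficient resampled belongs to the cut-off at the `i`-th centre in a
direction where `T^[i] x` and `T^[i] y` differ most. Its slope in the `i`-th difference is
comparable to their distance, and it does not affect the other times. The constant is uniform in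
`v`, `x`, `y` because only finitely many weights occur. -/
theorem exists_uniformPi_delay_close_le [NeZero N] [CompactSpace X] {T : X → X}
    {w : ℕ × ℕ × Fin N → ℝ} (hw : ∀ i, 0 < w i) (hs : Summable fun i => ‖w i • probe X i‖)
    {k : ℕ} {q : Fin k → ℕ} {m : ℕ} (hq : SeparatedCenters N q m) :
    ∃ C : ℝ, 0 < C ∧ ∀ (v : LipFun X) (x y : X), x ∈ tube T q m → y ∈ tube T q m →
      ∀ δ : ℝ, 0 < δ →
        uniformPi (ℕ × ℕ × Fin N) {α | ∀ i : Fin k,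
          |(v + unitSeries (fun i => w i • probe X i) α) (T^[i] x) -
            (v + unitSeries (fun i => w i • probe X i) α) (T^[i] y)| < δ} ≤
        ∏ i : Fin k, min 1 (ENNReal.ofReal (C * δ) / edist (T^[i] x) (T^[i] y)) := by
  obtain ⟨κ, hκ, hκw⟩ : ∃ κ > 0, ∀ (i : Fin k) (c : Fin N), κ ≤ w (q i, m, c) := by
    rcases isEmpty_or_nonempty (Fin k) with he | hne
    · exact ⟨1, one_pos, fun i => he.elim i⟩
    · obtain ⟨p, -, hp⟩ := Finset.exists_min_image Finset.univ
        (fun p : Fin k × Fin N => w (q p.1, m, p.2)) Finset.univ_nonempty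
      exact ⟨_, hw _, fun i c => hp (i, c) (Finset.mem_univ _)⟩
  have hN : (0 : ℝ) < N := by exact_mod_cast NeZero.pos N
  refine ⟨2 * N / κ, by positivity, fun v x y hx hy δ hδ => ?_⟩
  choose c hc using fun i : Fin k =>
    EuclideanSpace.exists_norm_le_mul_abs ((T^[i] x : EuclideanSpace ℝ (Fin N)) -
      (T^[i] y : EuclideanSpace ℝ (Fin N)))
  set r : ℝ := 1 / ((m : ℝ) + 1)
  have hr : 0 < r := by positivity
  set n : Fin k → ℕ × ℕ × Fin N := fun i => (q i, m, c i)
  -- A point within `r` of centre `q i` is at distance at least `3r - r = 2r` from centre `q j`,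
  -- where the cut-off vanishes.
  have hfar : ∀ i j, i ≠ j → ∀ z ∈ tube T q m, probe X (n j) (T^[i] z) = 0 := by
    intro i j hij z hz
    refine cutoffCoord_of_le ?_ _
    have h1 := hq i j hij
    have h2 : dist (T^[i] z : EuclideanSpace ℝ (Fin N)) (center N (q i)) < r := hz i
    have h3 := dist_triangle_left (center N (q i)) (center N (q j))
      (T^[i] z : EuclideanSpace ℝ (Fin N))
    change 2 * r ≤ dist _ (center N (q j))
    linarith
  have hnear : ∀ i, ∀ z ∈ tube T q m, probe X (n i) (T^[i] z) =
      (T^[i] z : EuclideanSpace ℝ (Fin N)) (c i) - center N (q i) (c i) := fun i z hz =>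
    cutoffCoord_of_lt (hz i) _
  set e := unitSeries fun i => w i • probe X i
  have hcont : Continuous e := continuous_unitSeries hs
  have heval : ∀ z : X, Continuous fun α => (v + e α) z := fun z =>
    LipFun.continuous_uncurry.comp ((continuous_const.add hcont).prodMk continuous_const)
  set Z : Fin k → ((ℕ × ℕ × Fin N) → unitInterval) → ℝ := fun i α =>
    (v + e α) (T^[i] x) - (v + e α) (T^[i] y)
  have hZ : ∀ i α j (s t : unitInterval), Z i (Function.update α (n j) s) -
      Z i (Function.update α (n j) t) = ((s : ℝ) - t) *
        (w (n j) * (probe X (n j) (T^[i] x) - probe X (n j) (T^[i] y))) := by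
    intro i α j s t
    have h1 := unitSeries_update_sub hs α (n j) s t
    have h2 : ∀ z : X, e (Function.update α (n j) s) z - e (Function.update α (n j) t) z =
        ((s : ℝ) - t) * (w (n j) * probe X (n j) z) := fun z => by
      rw [← LipFun.sub_apply, h1, LipFun.smul_apply, LipFun.smul_apply]
    have h3 := h2 (T^[i] x)
    have h4 := h2 (T^[i] y)
    simp only [Z, LipFun.add_apply]
    linear_combination h3 - h4
  have hmain := uniformPi_forall_abs_lt_le (n := n) (Z := Z)
    (a := fun i => w (n i) * (probe X (n i) (T^[i] x) - probe X (n i) (T^[i] y))) (δ := δ)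
    (fun i => ((heval _).sub (heval _)).measurable) (fun i α s t => hZ i α i s t)
    fun i j hij α t => by
      have h1 := hZ i α j t (α (n j))
      rw [hfar i j hij x hx, hfar i j hij y hy, Function.update_eq_self] at h1
      linarith
  refine hmain.trans (Finset.prod_le_prod' fun i _ => min_le_min le_rfl ?_)
  rw [edist_dist]
  have h1 : dist (T^[i] x) (T^[i] y) ≤
      N * |probe X (n i) (T^[i] x) - probe X (n i) (T^[i] y)| := by
    rw [hnear i x hx, hnear i y hy, sub_sub_sub_cancel_right, Subtype.dist_eq, dist_eq_norm]
    exact hc i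
  set b := |probe X (n i) (T^[i] x) - probe X (n i) (T^[i] y)|
  have hw' : κ ≤ w (n i) := hκw i (c i)
  have h2 : |w (n i) * (probe X (n i) (T^[i] x) - probe X (n i) (T^[i] y))| = w (n i) * b := by
    rw [abs_mul, abs_of_pos (hw _)]
  rw [h2]
  have hb : 0 ≤ b := abs_nonneg _
  refine ofReal_div_ofReal_le (by positivity) dist_nonneg ?_ ?_
  · calc 2 * δ * dist (T^[i] x) (T^[i] y) ≤ 2 * δ * (N * b) := by gcongr
      _ = 2 * N / κ * δ * (κ * b) := by field_simp
      _ ≤ _ := by gcongr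
  · intro hd
    exact mul_pos (hw _) (pos_of_mul_pos_right (hd.trans_le h1) hN.le)

end Probe

/-! ### Uniform decay along orbits -/

theorem exists_antilipschitzWith_iterate {X : Type*} [PseudoEMetricSpace X] {c : NNReal} {T : X → X}
    (hT : AntilipschitzWith c T) (n : ℕ) : ∃ c', AntilipschitzWith c' T^[n] := by
  induction n with
  | zero => exact ⟨1, AntilipschitzWith.id⟩
  | succ n ih =>
    obtain ⟨c', hc'⟩ := ih
    exact ⟨_, hc'.comp hT⟩

section Decay

variable {X : Type*} [MetricSpace X] [MeasurableSpace X]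

/-- The points `x` such that `μ {y | dist (f x) (f y) < r} ≤ M * r ^ s` at all rational scales. -/
def decaySet (μ : Measure X) (f : X → X) (s : ℝ) (M : ℕ) : Set X :=
  {x | ∀ r : ℚ, 0 < r → μ {y | dist (f x) (f y) < r} ≤ M * ENNReal.ofReal ((r : ℝ) ^ s)}

theorem decaySet_mono (μ : Measure X) (f : X → X) (s : ℝ) : Monotone (decaySet μ f s) :=
  fun _ _ h _ hx r hr => (hx r hr).trans (by gcongr)

theorem measure_lt_le_of_mem_decaySet {μ : Measure X} {f : X → X} {s : ℝ} (hs : 0 ≤ s) {M : ℕ}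
    {x : X} (hx : x ∈ decaySet μ f s M) {r : ℝ} (hr : 0 < r) :
    μ {y | dist (f x) (f y) < r} ≤ M * ENNReal.ofReal (2 ^ s) * ENNReal.ofReal (r ^ s) := by
  -- Rounding up to a rational scale below `2 * r` costs the factor `2 ^ s`.
  obtain ⟨p, h1, h2⟩ := exists_rat_btwn (by linarith : r < 2 * r)
  have hp : 0 < p := by exact_mod_cast hr.trans h1
  calc μ {y | dist (f x) (f y) < r} ≤ μ {y | dist (f x) (f y) < p} :=
        measure_mono fun y hy => lt_trans hy h1
    _ ≤ M * ENNReal.ofReal ((p : ℝ) ^ s) := hx p hp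
    _ ≤ M * ENNReal.ofReal ((2 * r) ^ s) := by
        gcongr
    _ = _ := by
        rw [Real.mul_rpow two_pos.le hr.le, ENNReal.ofReal_mul (by positivity), mul_assoc]

theorem exists_mem_decaySet {μ : Measure X} {f : X → X} {s : ℝ} {x : X} {C : ENNReal}
    (hC : C ≠ ⊤)
    (h : ∀ r : ℝ, 0 < r → μ {y | dist (f x) (f y) < r} ≤ C * ENNReal.ofReal (r ^ s)) :
    ∃ M, x ∈ decaySet μ f s M := by
  obtain ⟨M, hM⟩ := ENNReal.exists_nat_gt hC
  exact ⟨M, fun r hr => (h r (by exact_mod_cast hr)).trans (by gcongr)⟩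

/-- The dimension controls scales below some `δ`; at larger scales the total mass is at most a
constant times `r ^ s`, because `s ≥ 0`. -/
theorem exists_mem_decaySet_of_lt {μ : Measure X} [IsFiniteMeasure μ] {s : ℝ} (hs : 0 ≤ s)
    {x : X} (h : (s : EReal) < lowerLocalDim μ x) : ∃ M, x ∈ decaySet μ id s M := by
  obtain ⟨δ, hδ, h1⟩ := mem_nhdsGT_iff_exists_Ioo_subset.1 (eventually_measure_ball_le h)
  have hδ : 0 < δ := hδ
  have hC : 1 + μ Set.univ * ENNReal.ofReal (δ⁻¹ ^ s) ≠ ⊤ :=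
    ENNReal.add_ne_top.2 ⟨ENNReal.one_ne_top,
      ENNReal.mul_ne_top (measure_ne_top _ _) ENNReal.ofReal_ne_top⟩
  refine exists_mem_decaySet hC fun r hr => ?_
  have e : {y | dist (id x) (id y) < r} = Metric.ball x r := by
    ext y; simp [dist_comm]
  rw [e, add_mul, one_mul]
  rcases lt_or_ge r δ with hlt | hge
  · exact le_add_right (h1 ⟨hr, hlt⟩)
  · refine le_add_left ?_
    rw [mul_assoc, ← ENNReal.ofReal_mul (by positivity), ← Real.mul_rpow (by positivity) hr.le]
    calc μ (Metric.ball x r) ≤ μ Set.univ * 1 := by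
          rw [mul_one]; exact measure_mono (Set.subset_univ _)
      _ ≤ _ := by
          gcongr
          rw [ENNReal.one_le_ofReal]
          refine Real.one_le_rpow ?_ hs
          rwa [inv_mul_eq_div, one_le_div hδ]

theorem measurableSet_decaySet [BorelSpace X] [SecondCountableTopology X] (μ : Measure X)
    [SFinite μ] {f : X → X} (hf : Continuous f) (s : ℝ) (M : ℕ) :
    MeasurableSet (decaySet μ f s M) := by
  have e : decaySet μ f s M = ⋂ (r : ℚ) (_ : 0 < r),
      {x | μ {y | dist (f x) (f y) < r} ≤ M * ENNReal.ofReal ((r : ℝ) ^ s)} := by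
    ext; simp [decaySet]
  rw [e]
  refine MeasurableSet.iInter fun r => MeasurableSet.iInter fun _ =>
    measurableSet_le ?_ measurable_const
  have ho : IsOpen {p : X × X | dist (f p.1) (f p.2) < r} := isOpen_lt
    ((hf.comp continuous_fst).dist (hf.comp continuous_snd)) continuous_const
  exact measurable_measure_prodMk_left ho.measurableSet

/-- Let `G` be the set of points with some decay constant. As `S` is Lipschitz and preserves `μ`,
decay at `S x` passes back to `x`, so `S ⁻¹' G ⊆ G`. Both sets have the same finite measure, hence
agree almost everywhere, which yields the opposite implication. -/
theorem ae_exists_apply_mem_decaySet [BorelSpace X] [SecondCountableTopology X] (μ : Measure X)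
    [IsFiniteMeasure μ] {S : X → X} {L : NNReal} (hS : LipschitzWith L S)
    (hμ : MeasurePreserving S μ μ) (s : ℝ) :
    ∀ᵐ x ∂μ, (∃ M, x ∈ decaySet μ id s M) → ∃ M, S x ∈ decaySet μ id s M := by
  set G : Set X := ⋃ M, decaySet μ id s M
  have hGm : MeasurableSet G :=
    MeasurableSet.iUnion fun M => measurableSet_decaySet μ continuous_id s M
  have hsub : S ⁻¹' G ⊆ G := fun x hx => by
    obtain ⟨M, hM⟩ := Set.mem_iUnion.1 hx
    obtain ⟨l, hl⟩ := exists_nat_gt L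
    have hl0 : (0 : ℝ) < l := by exact_mod_cast (zero_le.trans_lt hl : (0 : NNReal) < l)
    have hC : (M : ENNReal) * ENNReal.ofReal ((l : ℝ) ^ s) ≠ ⊤ :=
      ENNReal.mul_ne_top (ENNReal.natCast_ne_top M) ENNReal.ofReal_ne_top
    obtain ⟨M', hM'⟩ := ENNReal.exists_nat_gt hC
    refine Set.mem_iUnion.2 ⟨M', fun r hr => ?_⟩
    have hr' : (0 : ℝ) < r := by exact_mod_cast hr
    have hsub : {y | dist (id x) (id y) < (r : ℝ)} ⊆
        S ⁻¹' {z | dist (id (S x)) (id z) < ((l * r : ℚ) : ℝ)} := fun y hy => by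
      have hy : dist x y < r := hy
      have h1 : (L : ℝ) ≤ l := by exact_mod_cast hl.le
      change dist (S x) (S y) < ((l * r : ℚ) : ℝ)
      push_cast
      calc dist (S x) (S y) ≤ L * dist x y := hS.dist_le_mul x y
        _ ≤ l * dist x y := mul_le_mul_of_nonneg_right h1 dist_nonneg
        _ < l * r := mul_lt_mul_of_pos_left hy hl0
    have hopen : IsOpen {z | dist (id (S x)) (id z) < ((l * r : ℚ) : ℝ)} :=
      isOpen_lt (continuous_const.dist continuous_id) continuous_const
    calc μ {y | dist (id x) (id y) < (r : ℝ)}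
        ≤ μ {z | dist (id (S x)) (id z) < ((l * r : ℚ) : ℝ)} :=
          (measure_mono hsub).trans
            (hμ.measure_preimage hopen.measurableSet.nullMeasurableSet).le
      _ ≤ M * ENNReal.ofReal ((((l * r : ℚ)) : ℝ) ^ s) :=
          hM (l * r) (mul_pos (by exact_mod_cast hl0) hr)
      _ = M * ENNReal.ofReal ((l : ℝ) ^ s) * ENNReal.ofReal ((r : ℝ) ^ s) := by
          push_cast
          rw [Real.mul_rpow hl0.le hr'.le, ENNReal.ofReal_mul (by positivity), mul_assoc]
      _ ≤ _ := by gcongr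
  have h0 : S ⁻¹' G =ᵐ[μ] G := ae_eq_of_subset_of_measure_ge hsub
    (hμ.measure_preimage hGm.nullMeasurableSet).ge
    (hμ.measurable hGm).nullMeasurableSet (measure_ne_top _ _)
  filter_upwards [h0.mem_iff] with x hx h
  exact Set.mem_iUnion.1 (hx.2 (Set.mem_iUnion.2 h))

theorem decaySet_eq_preimage [OpensMeasurableSpace X] {μ : Measure X} {S : X → X}
    (hμ : MeasurePreserving S μ μ) (s : ℝ) (M : ℕ) :
    decaySet μ S s M = S ⁻¹' decaySet μ id s M := by
  ext x
  refine forall₂_congr fun r _ => ?_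
  have hopen : IsOpen {z | dist (id (S x)) (id z) < (r : ℝ)} :=
    isOpen_lt (continuous_const.dist continuous_id) continuous_const
  rw [← hμ.measure_preimage hopen.measurableSet.nullMeasurableSet]
  rfl

theorem exists_mem_decaySet_of_antilipschitz {μ : Measure X} {S : X → X} {c : NNReal}
    (hS : AntilipschitzWith c S) {s : ℝ} (hs : 0 ≤ s) {x : X}
    (h : ∃ M, x ∈ decaySet μ id s M) : ∃ M, x ∈ decaySet μ S s M := by
  obtain ⟨M, hM⟩ := h
  have hC : (M : ENNReal) * ENNReal.ofReal (2 ^ s) * ENNReal.ofReal ((c + 1 : ℝ) ^ s) ≠ ⊤ :=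
    ENNReal.mul_ne_top (ENNReal.mul_ne_top (ENNReal.natCast_ne_top M) ENNReal.ofReal_ne_top)
      ENNReal.ofReal_ne_top
  refine exists_mem_decaySet hC fun r hr => ?_
  have hc : (0 : ℝ) < c + 1 := by positivity
  have h1 := measure_lt_le_of_mem_decaySet hs hM (mul_pos hc hr)
  rw [Real.mul_rpow hc.le hr.le, ENNReal.ofReal_mul (by positivity), ← mul_assoc] at h1
  refine (measure_mono fun y hy => ?_).trans h1
  calc dist x y ≤ c * dist (S x) (S y) := hS.le_mul_dist x y
    _ ≤ (c + 1) * dist (S x) (S y) := mul_le_mul_of_nonneg_right (by linarith) dist_nonneg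
    _ < (c + 1) * r := mul_lt_mul_of_pos_left hy hc

theorem ae_exists_forall_mem_decaySet_iterate [BorelSpace X] [SecondCountableTopology X]
    (μ : Measure X) [IsFiniteMeasure μ] {T : X → X} {L : NNReal} (hT : LipschitzWith L T)
    (hTμ : MeasurePreserving T μ μ ∨ ∃ c : NNReal, AntilipschitzWith c T) (k : ℕ) {s : ℝ}
    (hs : 0 ≤ s) :
    ∀ᵐ x ∂μ, (∃ M, x ∈ decaySet μ id s M) → ∃ M, ∀ i : Fin k, x ∈ decaySet μ T^[i] s M := by
  have h : ∀ i : Fin k, ∀ᵐ x ∂μ, (∃ M, x ∈ decaySet μ id s M) →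
      ∃ M, x ∈ decaySet μ T^[i] s M := fun i => by
    rcases hTμ with hμ | ⟨c, hc⟩
    · filter_upwards [ae_exists_apply_mem_decaySet μ (hT.iterate i) (hμ.iterate i) s] with x hx h
      simpa only [decaySet_eq_preimage (hμ.iterate i), Set.mem_preimage] using hx h
    · obtain ⟨c', hc'⟩ := exists_antilipschitzWith_iterate hc i
      exact Eventually.of_forall fun x => exists_mem_decaySet_of_antilipschitz hc' hs
  filter_upwards [ae_all_iff.2 h] with x hx hM
  choose M hM using fun i => hx i hM
  exact ⟨Finset.univ.sup M, fun i =>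
    decaySet_mono μ _ s (Finset.le_sup (Finset.mem_univ i)) (hM i)⟩

/-- A coincidence `T^[i] x = T^[j] x` with `i < j` makes `T^[i] x` periodic of period `j - i`.
Invariance excludes this almost everywhere; if `T` is injective, cancelling `T^[i]` makes `x` itself
periodic. -/
theorem ae_injective_iterate [BorelSpace X] (μ : Measure X) {T : X → X}
    (hTμ : MeasurePreserving T μ μ ∨ Function.Injective T) (k : ℕ)
    (hPer : μ (⋃ p ∈ Set.Ico 1 k, {x : X | T^[p] x = x}) = 0) :
    ∀ᵐ x ∂μ, Function.Injective fun i : Fin k => T^[i] x := by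
  set P := ⋃ p ∈ Set.Ico 1 k, {x : X | T^[p] x = x}
  have h0 : ∀ᵐ x ∂μ, x ∉ P := measure_eq_zero_iff_ae_notMem.1 hPer
  have h : ∀ i : Fin k, ∀ᵐ x ∂μ, ∀ j : Fin k, i < j → T^[i] x ≠ T^[j] x := fun i => by
    have hadd : ∀ (x : X) (j : Fin k), i < j → T^[j] x = T^[i] (T^[(j : ℕ) - i] x) ∧
        T^[j] x = T^[(j : ℕ) - i] (T^[i] x) := fun x j hij => by
      have hij' : (i : ℕ) ≤ j := hij.le
      rw [← Function.iterate_add_apply, ← Function.iterate_add_apply, Nat.add_sub_cancel' hij',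
        Nat.sub_add_cancel hij']
      exact ⟨rfl, rfl⟩
    have hmem : ∀ (x : X) (j : Fin k), i < j → T^[(j : ℕ) - i] x = x → x ∈ P :=
      fun x j hij hx => Set.mem_biUnion (x := (j : ℕ) - i)
        ⟨by have : (i : ℕ) < j := hij; omega, by have := j.2; omega⟩ hx
    rcases hTμ with hμ | hinj
    · filter_upwards [(hμ.iterate i).quasiMeasurePreserving.ae h0] with x hx j hij e
      exact hx (hmem _ j hij (by rw [← (hadd x j hij).2, e]))
    · filter_upwards [h0] with x hx j hij e
      refine hx (hmem x j hij (hinj.iterate i ?_))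
      rw [← (hadd x j hij).1, e]
  filter_upwards [ae_all_iff.2 h] with x hx i j hij
  rcases lt_trichotomy i j with h1 | h1 | h1
  · exact absurd hij (hx i j h1)
  · exact h1
  · exact absurd hij.symm (hx j i h1)

end Decay

/-! ### Dyadic estimate of the truncated potential -/

section DyadicSum

theorem min_one_div_pow_le_tsum (k : ℕ) {c t : ℝ} (hc : 0 < c) :
    (min 1 (ENNReal.ofReal c / ENNReal.ofReal t)) ^ k ≤
      ∑' j : ℕ, {t : ℝ | t < 2 ^ j * c}.indicator
        (fun _ => ENNReal.ofReal (2 ^ k * ((2 ^ k)⁻¹) ^ j)) t := by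
  classical
  have hex : ∃ j : ℕ, t < 2 ^ j * c := by
    obtain ⟨j, hj⟩ := pow_unbounded_of_one_lt (t / c) (one_lt_two (α := ℝ))
    exact ⟨j, (div_lt_iff₀ hc).1 hj⟩
  -- The term of the first `j` with `t < 2 ^ j * c` suffices: for `j > 0`, minimality gives `c / t ≤
  -- 2 ^ (1 - j)`.
  refine le_trans ?_ (ENNReal.le_tsum (Nat.find hex))
  rw [Set.indicator_of_mem (s := {t : ℝ | t < 2 ^ (Nat.find hex) * c}) (Nat.find_spec hex)]
  rcases Nat.eq_zero_or_pos (Nat.find hex) with h0 | hpos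
  · rw [h0, pow_zero, mul_one]
    refine (pow_le_one' (min_le_left _ _) k).trans ?_
    rw [ENNReal.one_le_ofReal]
    exact one_le_pow₀ one_le_two
  · obtain ⟨j, hj⟩ : ∃ j, Nat.find hex = j + 1 := ⟨_, (Nat.succ_pred_eq_of_pos hpos).symm⟩
    have h1 : 2 ^ j * c ≤ t := not_lt.1 (Nat.find_min hex (by omega : j < Nat.find hex))
    have ht : 0 < t := lt_of_lt_of_le (by positivity) h1
    rw [hj]
    have e : (2 : ℝ) ^ k * ((2 ^ k)⁻¹) ^ (j + 1) = ((2 ^ j)⁻¹) ^ k := by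
      rw [pow_succ, mul_comm (((2 : ℝ) ^ k)⁻¹ ^ j), ← mul_assoc,
        mul_inv_cancel₀ (by positivity), one_mul, inv_pow, inv_pow, ← pow_mul, ← pow_mul,
        mul_comm]
    rw [e, ENNReal.ofReal_pow (by positivity), ← ENNReal.ofReal_div_of_pos ht]
    gcongr
    refine (min_le_right _ _).trans (ENNReal.ofReal_le_ofReal ?_)
    rw [div_le_iff₀ ht, inv_mul_eq_div, le_div_iff₀ (by positivity)]
    linarith

/-- The scale `2 ^ j * c` contributes at most a constant times `2 ^ (j * (s - k)) * c ^ s`, a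
convergent geometric series because `s < k`. Here `K` depends on `M`, `s`, `k` only, so it serves
all iterates at once. -/
theorem exists_lintegral_min_pow_le {X : Type*} [MetricSpace X] [MeasurableSpace X]
    [OpensMeasurableSpace X] (μ : Measure X) {k : ℕ} {s : ℝ} (hs : 0 ≤ s) (hsk : s < k) (M : ℕ) :
    ∃ K : ENNReal, K ≠ ⊤ ∧ ∀ {f : X → X} (_ : Continuous f) (x : X), x ∈ decaySet μ f s M →
      ∀ c : ℝ, 0 < c →
      ∫⁻ y, (min 1 (ENNReal.ofReal c / edist (f x) (f y))) ^ k ∂μ ≤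
        K * ENNReal.ofReal (c ^ s) := by
  set ρ : ENNReal := ENNReal.ofReal ((2 ^ k)⁻¹ * 2 ^ s) with hρ
  have hρ1 : ρ < 1 := by
    rw [hρ, ENNReal.ofReal_lt_one, inv_mul_eq_div, div_lt_one (by positivity),
      ← Real.rpow_natCast]
    exact Real.rpow_lt_rpow_of_exponent_lt one_lt_two hsk
  set A : ENNReal := ENNReal.ofReal (2 ^ k) * (M * ENNReal.ofReal (2 ^ s))
  have hA : A ≠ ⊤ := ENNReal.mul_ne_top ENNReal.ofReal_ne_top
    (ENNReal.mul_ne_top (ENNReal.natCast_ne_top M) ENNReal.ofReal_ne_top)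
  refine ⟨A * (1 - ρ)⁻¹, ENNReal.mul_ne_top hA
    (ENNReal.inv_ne_top.2 (tsub_pos_of_lt hρ1).ne'), ?_⟩
  intro f hf x hx c hc
  have hm : ∀ j : ℕ, MeasurableSet {y | dist (f x) (f y) < 2 ^ j * c} := fun j =>
    (isOpen_lt (continuous_const.dist hf) continuous_const).measurableSet
  calc ∫⁻ y, (min 1 (ENNReal.ofReal c / edist (f x) (f y))) ^ k ∂μ
      ≤ ∫⁻ y, ∑' j : ℕ, {y | dist (f x) (f y) < 2 ^ j * c}.indicator
        (fun _ => ENNReal.ofReal (2 ^ k * ((2 ^ k)⁻¹) ^ j)) y ∂μ := by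
        refine lintegral_mono fun y => ?_
        rw [edist_dist]
        exact min_one_div_pow_le_tsum k hc
    _ = ∑' j : ℕ, ENNReal.ofReal (2 ^ k * ((2 ^ k)⁻¹) ^ j) *
          μ {y | dist (f x) (f y) < 2 ^ j * c} := by
        rw [lintegral_tsum fun j => (measurable_const.indicator (hm j)).aemeasurable]
        exact tsum_congr fun j => lintegral_indicator_const (hm j) _
    _ ≤ ∑' j : ℕ, (A * ENNReal.ofReal (c ^ s)) * ρ ^ j := by
        refine ENNReal.tsum_le_tsum fun j => ?_
        refine (mul_le_mul_right (measure_lt_le_of_mem_decaySet hs hx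
          (by positivity : 0 < 2 ^ j * c)) _).trans_eq ?_
        have e : ((2 : ℝ) ^ j * c) ^ s = (2 ^ s) ^ j * c ^ s := by
          rw [Real.mul_rpow (by positivity) hc.le, ← Real.rpow_natCast, ← Real.rpow_natCast,
            ← Real.rpow_mul two_pos.le, ← Real.rpow_mul two_pos.le, mul_comm s]
        rw [e, hρ, ENNReal.ofReal_mul (by positivity), ENNReal.ofReal_mul (by positivity),
          ENNReal.ofReal_mul (by positivity), mul_pow,
          ENNReal.ofReal_pow (by positivity : 0 ≤ ((2 : ℝ) ^ k)⁻¹) j,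
          ENNReal.ofReal_pow (by positivity : 0 ≤ (2 : ℝ) ^ s) j]
        simp only [A]
        ring
    _ = A * (1 - ρ)⁻¹ * ENNReal.ofReal (c ^ s) := by
        rw [ENNReal.tsum_mul_left, ENNReal.tsum_geometric]; ring

end DyadicSum

/-! ### Energy of pairs with close delay vectors -/

section Energy

variable {N : ℕ} {X : Set (EuclideanSpace ℝ (Fin N))}

/-- The points whose delay vector is within `δ` of that of `x` in every coordinate. -/
def delayClose (T : X → X) (k : ℕ) (h : LipFun X) (x : X) (δ : ℝ) : Set X :=
  {y | ∀ i : Fin k, |h (T^[i] x) - h (T^[i] y)| < δ}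

theorem ball_delayMap_subset (T : X → X) (k : ℕ) (h : LipFun X) (x : X) (δ : ℝ) :
    delayMap T k h ⁻¹' Metric.ball (delayMap T k h x) δ ⊆ delayClose T k h x δ := fun y hy i => by
  have h1 : dist (delayMap T k h y) (delayMap T k h x) < δ := hy
  rw [dist_comm, dist_eq_norm] at h1
  exact (EuclideanSpace.abs_apply_le (delayMap T k h x - delayMap T k h y) i).trans_lt h1

theorem exists_lipschitzWith_delayMap {T : X → X} {L : NNReal} (hT : LipschitzWith L T) (k : ℕ)
    (h : LipFun X) : ∃ K, LipschitzWith K (delayMap T k h) := by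
  obtain ⟨H, hH⟩ := h.2
  refine ⟨k * ∑ i : Fin k, H * L ^ (i : ℕ), LipschitzWith.of_dist_le_mul fun x y => ?_⟩
  rcases Nat.eq_zero_or_pos k with rfl | hk
  · rw [Subsingleton.elim (delayMap T 0 h x) (delayMap T 0 h y), dist_self]
    positivity
  have : NeZero k := ⟨hk.ne'⟩
  obtain ⟨c, hc⟩ := EuclideanSpace.exists_norm_le_mul_abs (delayMap T k h x - delayMap T k h y)
  have h1 : dist (h (T^[c] x)) (h (T^[c] y)) ≤ (H * L ^ (c : ℕ) : NNReal) * dist x y :=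
    (hH.comp (hT.iterate c)).dist_le_mul x y
  have h2 : H * L ^ (c : ℕ) ≤ ∑ i : Fin k, H * L ^ (i : ℕ) :=
    Finset.single_le_sum_of_canonicallyOrdered (f := fun i : Fin k => H * L ^ (i : ℕ))
      (Finset.mem_univ c)
  rw [dist_eq_norm, NNReal.coe_mul, NNReal.coe_natCast, mul_assoc]
  refine hc.trans (mul_le_mul_of_nonneg_left (h1.trans ?_) (by positivity))
  exact mul_le_mul_of_nonneg_right (by exact_mod_cast h2) dist_nonneg

variable [CompactSpace X]

theorem isOpen_delayClose {Ω : Type*} [TopologicalSpace Ω] {T : X → X} (hT : Continuous T)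
    (k : ℕ) {g : Ω → LipFun X} {a b : Ω → X} (hg : Continuous g) (ha : Continuous a)
    (hb : Continuous b) (δ : ℝ) : IsOpen {p | b p ∈ delayClose T k (g p) (a p) δ} := by
  have e : {p | b p ∈ delayClose T k (g p) (a p) δ} = ⋂ i : Fin k,
      {p | |g p (T^[i] (a p)) - g p (T^[i] (b p))| < δ} := by ext; simp [delayClose]
  rw [e]
  exact isOpen_iInter_of_finite fun i => isOpen_lt
    ((LipFun.continuous_uncurry.comp (hg.prodMk ((hT.iterate i).comp ha))).sub
      (LipFun.continuous_uncurry.comp (hg.prodMk ((hT.iterate i).comp hb)))).abs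
    continuous_const

variable (μ : Measure X) [IsFiniteMeasure μ]

/-- The measure of the pairs in `A × U` whose delay vectors are `δ`-close. -/
def closeEnergy (T : X → X) (k : ℕ) (A U : Set X) (δ : ℝ) (h : LipFun X) : ENNReal :=
  ∫⁻ x in A, μ.restrict U (delayClose T k h x δ) ∂μ

theorem measurable_measure_delayClose {Ω : Type*} [TopologicalSpace Ω] [MeasurableSpace Ω]
    [OpensMeasurableSpace Ω] {T : X → X} (hT : Continuous T) (k : ℕ) (U : Set X) (δ : ℝ)
    {g : Ω → LipFun X} (hg : Continuous g) :
    Measurable fun p : Ω × X => μ.restrict U (delayClose T k (g p.1) p.2 δ) :=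
  measurable_measure_prodMk_left (isOpen_delayClose hT k
    (hg.comp (continuous_fst.comp continuous_fst)) (continuous_snd.comp continuous_fst)
    (continuous_snd : Continuous fun p : (Ω × X) × X => p.2) δ).measurableSet

theorem measurable_closeEnergy {T : X → X} (hT : Continuous T) (k : ℕ) (A U : Set X) (δ : ℝ) :
    Measurable (closeEnergy μ T k A U δ) :=
  (measurable_measure_delayClose μ hT k U δ continuous_id).lintegral_prod_right'

/-- The points with uniform decay along the orbit which lie in a given tube. -/
def decayTube (T : X → X) {k : ℕ} (s : ℝ) (M : ℕ) (q : Fin k → ℕ) (m : ℕ) : Set X :=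
  (⋂ i : Fin k, decaySet μ T^[i] s M) ∩ tube T q m

theorem measurableSet_decayTube {T : X → X} (hT : Continuous T) {k : ℕ} (s : ℝ) (M : ℕ)
    (q : Fin k → ℕ) (m : ℕ) : MeasurableSet (decayTube μ T s M q m) :=
  (MeasurableSet.iInter fun i : Fin k => measurableSet_decaySet μ (hT.iterate i) s M).inter
    (isOpen_tube hT q m).measurableSet

/-- The product is at most the `k`-th power of its largest factor. This decouples the `k` times, so
only the decay at each single time is needed. -/
theorem ENNReal.prod_le_sum_pow {k : ℕ} (hk : 1 ≤ k) (b : Fin k → ENNReal) :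
    ∏ i, b i ≤ ∑ i, b i ^ k := by
  have : NeZero k := ⟨by omega⟩
  obtain ⟨j, -, hj⟩ := Finset.exists_max_image Finset.univ b Finset.univ_nonempty
  calc ∏ i, b i ≤ ∏ _i : Fin k, b j := Finset.prod_le_prod' hj
    _ = b j ^ k := by simp
    _ ≤ _ := Finset.single_le_sum_of_canonicallyOrdered (f := fun i => b i ^ k)
        (Finset.mem_univ j)

/-- By Tonelli, the coefficients are averaged first for fixed `x` and `y`, where transversality
applies; the decay at `x` then bounds the integral over `y`. -/
theorem exists_lintegral_closeEnergy_le [NeZero N] {T : X → X} (hT : Continuous T)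
    {w : ℕ × ℕ × Fin N → ℝ} (hw : ∀ i, 0 < w i) (hs : Summable fun i => ‖w i • probe X i‖)
    {k : ℕ} (hk : 1 ≤ k) {q : Fin k → ℕ} {m : ℕ} (hq : SeparatedCenters N q m) {s : ℝ}
    (hs0 : 0 ≤ s) (hsk : s < k) (M : ℕ) :
    ∃ K : ENNReal, K ≠ ⊤ ∧ ∀ (v : LipFun X) (δ : ℝ), 0 < δ →
      ∫⁻ α, closeEnergy μ T k (decayTube μ T s M q m) (tube T q m) δ
        (v + unitSeries (fun i => w i • probe X i) α) ∂uniformPi (ℕ × ℕ × Fin N) ≤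
        K * ENNReal.ofReal (δ ^ s) := by
  obtain ⟨C, hC, hclose⟩ := exists_uniformPi_delay_close_le (T := T) hw hs hq
  obtain ⟨K, hK, hint⟩ := exists_lintegral_min_pow_le μ hs0 hsk M
  refine ⟨(k * (K * ENNReal.ofReal (C ^ s))) * μ Set.univ, ENNReal.mul_ne_top
    (ENNReal.mul_ne_top (ENNReal.natCast_ne_top k) (ENNReal.mul_ne_top hK
      ENNReal.ofReal_ne_top)) (measure_ne_top _ _), fun v δ hδ => ?_⟩
  set A := decayTube μ T s M q m
  set U := tube T q m
  set g := fun α => v + unitSeries (fun i => w i • probe X i) α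
  have hg : Continuous g := continuous_const.add (continuous_unitSeries hs)
  have hU : MeasurableSet U := (isOpen_tube hT q m).measurableSet
  have hpt : ∀ x ∈ A, ∫⁻ α, μ.restrict U (delayClose T k (g α) x δ)
      ∂uniformPi (ℕ × ℕ × Fin N) ≤ k * (K * ENNReal.ofReal (C ^ s)) * ENNReal.ofReal (δ ^ s) := by
    intro x hx
    have hS : MeasurableSet {p : ((ℕ × ℕ × Fin N) → unitInterval) × X |
        p.2 ∈ delayClose T k (g p.1) x δ} :=
      (isOpen_delayClose hT k (hg.comp continuous_fst) continuous_const continuous_snd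
        δ).measurableSet
    calc ∫⁻ α, μ.restrict U (delayClose T k (g α) x δ) ∂uniformPi (ℕ × ℕ × Fin N)
        = ∫⁻ y in U, uniformPi (ℕ × ℕ × Fin N) {α | y ∈ delayClose T k (g α) x δ} ∂μ :=
          (Measure.prod_apply hS).symm.trans (Measure.prod_apply_symm hS)
      _ ≤ ∫⁻ y in U, ∑ i : Fin k,
            (min 1 (ENNReal.ofReal (C * δ) / edist (T^[i] x) (T^[i] y))) ^ k ∂μ :=
          setLIntegral_mono' hU fun y hy => (hclose v x y hx.2 hy δ hδ).trans
            (ENNReal.prod_le_sum_pow hk _)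
      _ ≤ ∫⁻ y, ∑ i : Fin k,
            (min 1 (ENNReal.ofReal (C * δ) / edist (T^[i] x) (T^[i] y))) ^ k ∂μ :=
          setLIntegral_le_lintegral _ _
      _ = ∑ i : Fin k, ∫⁻ y,
            (min 1 (ENNReal.ofReal (C * δ) / edist (T^[i] x) (T^[i] y))) ^ k ∂μ := by
          refine lintegral_finsetSum _ fun i _ => ?_
          exact (measurable_const.min (measurable_const.div
            (continuous_const.edist (hT.iterate i)).measurable)).pow_const k
      _ ≤ ∑ _i : Fin k, K * ENNReal.ofReal ((C * δ) ^ s) := Finset.sum_le_sum fun i _ =>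
          hint (hT.iterate i) x (Set.mem_iInter.1 hx.1 i) _ (by positivity)
      _ = _ := by
          rw [Real.mul_rpow hC.le hδ.le, ENNReal.ofReal_mul (by positivity)]
          simp only [Finset.sum_const, Finset.card_univ, Fintype.card_fin, nsmul_eq_mul]
          ring
  calc ∫⁻ α, closeEnergy μ T k A U δ (g α) ∂uniformPi (ℕ × ℕ × Fin N)
      = ∫⁻ x in A, ∫⁻ α, μ.restrict U (delayClose T k (g α) x δ)
          ∂uniformPi (ℕ × ℕ × Fin N) ∂μ :=
        lintegral_lintegral_swap (measurable_measure_delayClose μ hT k U δ hg).aemeasurable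
    _ ≤ ∫⁻ _x in A, k * (K * ENNReal.ofReal (C ^ s)) * ENNReal.ofReal (δ ^ s) ∂μ :=
        setLIntegral_mono' (measurableSet_decayTube μ hT s M q m) hpt
    _ ≤ k * (K * ENNReal.ofReal (C ^ s)) * ENNReal.ofReal (δ ^ s) * μ Set.univ := by
        rw [setLIntegral_const]; gcongr; exact Set.subset_univ _
    _ = _ := by ring

/-- The dyadic energy sum with exponent `t`. -/
def energySum (T : X → X) (k : ℕ) (t : ℝ) (A U : Set X) (h : LipFun X) : ENNReal :=
  ∑' n : ℕ, ENNReal.ofReal ((2 ^ t) ^ n) * closeEnergy μ T k A U ((1 / 2) ^ n) h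

theorem measurable_energySum {T : X → X} (hT : Continuous T) (k : ℕ) (t : ℝ) (A U : Set X) :
    Measurable (energySum μ T k t A U) :=
  Measurable.tsum fun _ => (measurable_closeEnergy μ hT k A U _).const_mul _

theorem ae_energySum_lt_top [NeZero N] {T : X → X} (hT : Continuous T)
    {w : ℕ × ℕ × Fin N → ℝ} (hw : ∀ i, 0 < w i) (hs : Summable fun i => ‖w i • probe X i‖)
    {k : ℕ} (hk : 1 ≤ k) {q : Fin k → ℕ} {m : ℕ} (hq : SeparatedCenters N q m) {s t : ℝ}
    (hs0 : 0 ≤ s) (hsk : s < k) (hts : t < s) (M : ℕ) (v : LipFun X) :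
    ∀ᵐ α ∂uniformPi (ℕ × ℕ × Fin N),
      energySum μ T k t (decayTube μ T s M q m) (tube T q m)
        (v + unitSeries (fun i => w i • probe X i) α) < ⊤ := by
  obtain ⟨K, hK, hint⟩ := exists_lintegral_closeEnergy_le μ hT hw hs hk hq hs0 hsk M
  have hg : Continuous fun α => v + unitSeries (fun i => w i • probe X i) α :=
    continuous_const.add (continuous_unitSeries hs)
  refine ae_lt_top ((measurable_energySum μ hT k t _ _).comp hg.measurable) ?_
  -- The ratio is `2 ^ (t - s)`, below one since `t < s`.
  set ρ : ENNReal := ENNReal.ofReal (2 ^ t * (1 / 2) ^ s) with hρ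
  have hρ1 : ρ < 1 := by
    rw [hρ, ENNReal.ofReal_lt_one, one_div, Real.inv_rpow two_pos.le, mul_inv_lt_iff₀
      (by positivity), one_mul]
    exact Real.rpow_lt_rpow_of_exponent_lt one_lt_two hts
  refine ne_top_of_le_ne_top (ENNReal.mul_ne_top hK
    (ENNReal.inv_ne_top.2 (tsub_pos_of_lt hρ1).ne')) ?_
  unfold energySum
  calc _ = ∑' n : ℕ, ENNReal.ofReal ((2 ^ t) ^ n) * ∫⁻ α, closeEnergy μ T k
          (decayTube μ T s M q m) (tube T q m) ((1 / 2) ^ n)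
          (v + unitSeries (fun i => w i • probe X i) α) ∂uniformPi (ℕ × ℕ × Fin N) := by
        have hm : ∀ n : ℕ, Measurable fun α => closeEnergy μ T k
            (decayTube μ T s M q m) (tube T q m) ((1 / 2) ^ n)
            (v + unitSeries (fun i => w i • probe X i) α) := fun n =>
          (measurable_closeEnergy μ hT k _ _ _).comp hg.measurable
        rw [lintegral_tsum fun n => ((hm n).const_mul _).aemeasurable]
        exact tsum_congr fun n => lintegral_const_mul _ (hm n)
    _ ≤ ∑' n : ℕ, K * ρ ^ n := by
        refine ENNReal.tsum_le_tsum fun n => ?_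
        refine (mul_le_mul_right (hint v _ (by positivity)) _).trans_eq ?_
        have e : (((1 : ℝ) / 2) ^ n) ^ s = ((1 / 2) ^ s) ^ n := by
          rw [← Real.rpow_natCast, ← Real.rpow_natCast, ← Real.rpow_mul (by positivity),
            ← Real.rpow_mul (by positivity), mul_comm]
        rw [e, hρ, ← ENNReal.ofReal_pow (by positivity), mul_pow,
          ENNReal.ofReal_mul (by positivity)]
        ring
    _ = K * (1 - ρ)⁻¹ := by rw [ENNReal.tsum_mul_left, ENNReal.tsum_geometric]

/-- Finiteness of the energy sum bounds the lower local dimension of the image from below. -/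
theorem ae_le_lowerLocalDim_of_energySum_lt_top {T : X → X} {L : NNReal}
    (hT : LipschitzWith L T) {k : ℕ} {h : LipFun X} {t : ℝ} (ht : 0 ≤ t) {A U : Set X}
    (hA : MeasurableSet A) (hAU : A ⊆ U) (hfin : energySum μ T k t A U h < ⊤) :
    ∀ᵐ x ∂μ, x ∈ A →
      (t : EReal) ≤ lowerLocalDim (μ.map (delayMap T k h)) (delayMap T k h x) := by
  obtain ⟨K, hK⟩ := exists_lipschitzWith_delayMap hT k h
  rw [← ae_restrict_iff' hA]
  have hm : ∀ n : ℕ, Measurable fun x =>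
      ENNReal.ofReal ((2 ^ t) ^ n) * μ.restrict U (delayClose T k h x ((1 / 2) ^ n)) := fun n =>
    (measurable_measure_delayClose μ hT.continuous k U _
      (continuous_const (y := h) : Continuous fun _ : X => h)).comp
        (measurable_id.prodMk measurable_id) |>.const_mul _
  have h1 : ∫⁻ x in A, ∑' n : ℕ, ENNReal.ofReal ((2 ^ t) ^ n) *
      μ.restrict U (delayClose T k h x ((1 / 2) ^ n)) ∂μ ≠ ⊤ := by
    rw [lintegral_tsum fun n => (hm n).aemeasurable]
    refine ne_of_eq_of_ne (tsum_congr fun n => ?_) hfin.ne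
    exact lintegral_const_mul' _ _ ENNReal.ofReal_ne_top
  filter_upwards [ae_lt_top (Measurable.tsum hm) h1, ae_mono (Measure.restrict_mono hAU
    le_rfl) (ae_le_lowerLocalDim_map μ hK.continuous.measurable U)] with x hx hlow
  set C := ∑' n : ℕ, ENNReal.ofReal ((2 ^ t) ^ n) *
      μ.restrict U (delayClose T k h x ((1 / 2) ^ n))
  refine hlow t (C * ENNReal.ofReal (2 ^ t)) (ENNReal.mul_ne_top hx.ne ENNReal.ofReal_ne_top) ?_
  filter_upwards [eventually_pos_lt_one] with δ hδ
  -- Here `(1/2) ^ (n + 1) < δ ≤ (1/2) ^ n`; each single term of the pointwise sum is at most `C`,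
  -- and rounding `δ` up costs `2 ^ t`.
  obtain ⟨n, hn1, hn2⟩ := exists_nat_pow_near_of_lt_one hδ.1 hδ.2.le
    (by norm_num : (0 : ℝ) < 1 / 2) (by norm_num)
  have h2 : ENNReal.ofReal ((2 ^ t) ^ n) *
      μ.restrict U (delayClose T k h x ((1 / 2) ^ n)) ≤ C := ENNReal.le_tsum n
  have h3 : μ.restrict U (delayMap T k h ⁻¹' Metric.ball (delayMap T k h x) δ) ≤
      μ.restrict U (delayClose T k h x ((1 / 2) ^ n)) :=
    measure_mono ((ball_delayMap_subset T k h x δ).trans fun y hy i => (hy i).trans_le hn2)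
  have hpos : (0 : ℝ) < ((2 : ℝ) ^ t) ^ n := by positivity
  have h4 : ENNReal.ofReal ((((2 : ℝ) ^ t) ^ n)⁻¹) * ENNReal.ofReal ((2 ^ t) ^ n) = 1 := by
    rw [← ENNReal.ofReal_mul (by positivity), inv_mul_cancel₀ hpos.ne', ENNReal.ofReal_one]
  have h5 : (((2 : ℝ) ^ t) ^ n)⁻¹ ≤ 2 ^ t * δ ^ t := by
    rw [← Real.mul_rpow two_pos.le hδ.1.le]
    have e : (((2 : ℝ) ^ t) ^ n)⁻¹ = ((1 / 2) ^ n) ^ t := by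
      rw [one_div, inv_pow, Real.inv_rpow (by positivity), ← Real.rpow_natCast,
        ← Real.rpow_natCast, ← Real.rpow_mul two_pos.le, ← Real.rpow_mul two_pos.le, mul_comm]
    rw [e]
    refine Real.rpow_le_rpow (by positivity) ?_ ht
    rw [pow_succ] at hn1
    linarith
  calc μ.restrict U (delayMap T k h ⁻¹' Metric.ball (delayMap T k h x) δ)
      ≤ ENNReal.ofReal ((((2 : ℝ) ^ t) ^ n)⁻¹) * (ENNReal.ofReal ((2 ^ t) ^ n) *
        μ.restrict U (delayClose T k h x ((1 / 2) ^ n))) := by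
        rw [← mul_assoc, h4, one_mul]; exact h3
    _ ≤ ENNReal.ofReal (2 ^ t * δ ^ t) * C := by gcongr
    _ = _ := by rw [ENNReal.ofReal_mul (by positivity)]; ring

end Energy

/-! ### Prevalence and the main theorem -/

section Main

theorem min_le_of_forall_rat {a c d : EReal} (hc : 0 ≤ c)
    (h : ∀ t s : ℚ, 0 ≤ t → t < s → ((s : ℝ) : EReal) < a → ((s : ℝ) : EReal) < d →
      ((t : ℝ) : EReal) ≤ c) : min a d ≤ c := by
  refine le_of_not_gt fun hlt => ?_
  obtain ⟨t, hct, ht⟩ := EReal.lt_iff_exists_rat_btwn.1 hlt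
  obtain ⟨s, hts, hs⟩ := EReal.lt_iff_exists_rat_btwn.1 ht
  have ht0 : (0 : EReal) ≤ ((t : ℝ) : EReal) := hc.trans hct.le
  exact absurd (h t s (by exact_mod_cast ht0) (by exact_mod_cast hts)
    (hs.trans_le (min_le_left _ _)) (hs.trans_le (min_le_right _ _))) (not_le.2 hct)

/-- The cube of coefficients is compact and the series depends continuously on it, so the law of the
series is a probability measure carried by a compact set. -/
theorem isPrevalent_of_ae_uniformPi {ι V : Type*} [Countable ι] [NormedAddCommGroup V]
    [NormedSpace ℝ V] [CompleteSpace V] [MeasurableSpace V] [BorelSpace V] {u : ι → V}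
    (hu : Summable fun i => ‖u i‖) {B S : Set V} (hBS : B ⊆ S) (hB : MeasurableSet B)
    (h : ∀ v, ∀ᵐ α ∂uniformPi ι, v + unitSeries u α ∈ B) : IsPrevalent S := by
  have hc : Continuous (unitSeries u) := continuous_unitSeries hu
  refine ⟨B, hBS, hB, (uniformPi ι).map (unitSeries u), ?_, fun v => ?_⟩
  · have hK : IsCompact (Set.range (unitSeries u)) := isCompact_range hc
    refine ⟨_, hK, ?_⟩
    rw [Measure.map_apply hc.measurable hK.isClosed.measurableSet, Set.preimage_range,
      measure_univ]
    exact ⟨one_pos, ENNReal.one_lt_top⟩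
  · rw [ae_map_iff hc.measurable.aemeasurable
      (hB.preimage (measurable_const_add v))]
    exact h v

end Main

end

theorem mainTheorem10 (N : ℕ) (hN : 1 ≤ N) (X : Set (EuclideanSpace ℝ (Fin N))) [CompactSpace X]
    (μ : Measure X) [IsProbabilityMeasure μ]
    (T : X → X) (hT : ∃ L : NNReal, LipschitzWith L T)
    (hTμ : MeasurePreserving T μ μ ∨ ∃ c : NNReal, AntilipschitzWith c T)
    (k : ℕ) (hk : 1 ≤ k)
    (hPer : μ (⋃ p ∈ Set.Ico 1 k, {x : X | T^[p] x = x}) = 0)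
    (hdim : ∀ᵐ x ∂μ, ∃ d : EReal, HasLocalDim μ x d) :
    IsPrevalent {h : LipFun X | ∀ᵐ x ∂μ, ∃ d : EReal, HasLocalDim μ x d ∧
      HasLocalDim (μ.map (delayMap T k h)) (delayMap T k h x) (min (k : EReal) d)} := by
  have : NeZero N := ⟨by omega⟩
  obtain ⟨L, hL⟩ := hT
  obtain ⟨w, hw, hs⟩ := exists_summable_weight (probe X)
  -- The Borel set is a countable intersection of finite-energy conditions; the rational pair is
  -- `(t, s)` with `0 ≤ t < s < k`.
  refine isPrevalent_of_ae_uniformPi (B := ⋂ (p : {p : ℚ × ℚ // 0 ≤ p.1 ∧ p.1 < p.2 ∧ p.2 < k})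
    (M : ℕ) (c : {c : (Fin k → ℕ) × ℕ // SeparatedCenters N c.1 c.2}),
    {h : LipFun X | energySum μ T k p.1.1 (decayTube μ T p.1.2 M c.1.1 c.1.2)
      (tube T c.1.1 c.1.2) h < ⊤}) hs (fun h hh => ?_) ?_ fun v => ?_
  · simp only [Set.mem_iInter] at hh
    have hlow : ∀ᵐ x ∂μ, ∀ (p : {p : ℚ × ℚ // 0 ≤ p.1 ∧ p.1 < p.2 ∧ p.2 < k}) (M : ℕ)
        (c : {c : (Fin k → ℕ) × ℕ // SeparatedCenters N c.1 c.2}),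
        x ∈ decayTube μ T p.1.2 M c.1.1 c.1.2 →
        (((p.1.1 : ℚ) : ℝ) : EReal) ≤
          lowerLocalDim (μ.map (delayMap T k h)) (delayMap T k h x) := by
      refine ae_all_iff.2 fun p => ae_all_iff.2 fun M => ae_all_iff.2 fun c => ?_
      exact ae_le_lowerLocalDim_of_energySum_lt_top μ hL (by exact_mod_cast p.2.1)
        (measurableSet_decayTube μ hL.continuous _ M _ _) Set.inter_subset_right (hh p M c)
    obtain ⟨K, hK⟩ := exists_lipschitzWith_delayMap hL k h
    have hdecay : ∀ᵐ x ∂μ, ∀ s : ℚ, 0 ≤ s → (∃ M, x ∈ decaySet μ id s M) →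
        ∃ M, ∀ i : Fin k, x ∈ decaySet μ T^[i] s M := ae_all_iff.2 fun s => by
      by_cases h0 : 0 ≤ s
      · filter_upwards [ae_exists_forall_mem_decaySet_iterate μ hL hTμ k
          (by exact_mod_cast h0 : (0 : ℝ) ≤ s)] with x hx _ using hx
      · exact Eventually.of_forall fun x h1 => absurd h1 h0
    filter_upwards [hdim, hlow, hdecay, ae_of_ae_map hK.continuous.measurable.aemeasurable
      (ae_upperLocalDim_le (μ.map (delayMap T k h))), ae_injective_iterate μ
      (hTμ.imp_right fun ⟨_, hc⟩ => hc.injective) k hPer] with x ⟨d, hd⟩ h1 h2 h3 h4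
    refine ⟨d, hd, ?_⟩
    obtain ⟨q, m, hq, hx⟩ := exists_mem_tube h4
    have hup : upperLocalDim (μ.map (delayMap T k h)) (delayMap T k h x) ≤ min (k : EReal) d :=
      le_min h3 (hd.2 ▸ upperLocalDim_map_le μ hK x)
    have hlo : min (k : EReal) d ≤
        lowerLocalDim (μ.map (delayMap T k h)) (delayMap T k h x) := by
      -- For `s < min k d`, the point `x` has decay of order `s` along its orbit and lies in a tube,
      -- so finite energy gives every `t < s`.
      refine min_le_of_forall_rat (zero_le_lowerLocalDim _ _) fun t s ht hts hsk hsd => ?_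
      have hs0 : 0 ≤ s := ht.trans hts.le
      obtain ⟨M, hM⟩ := h2 s hs0 (exists_mem_decaySet_of_lt (by exact_mod_cast hs0)
        (hd.1.symm ▸ hsd))
      exact h1 ⟨(t, s), ht, hts, by exact_mod_cast hsk⟩ M ⟨(q, m), hq⟩
        ⟨Set.mem_iInter.2 hM, hx⟩
    have hle := lowerLocalDim_le_upperLocalDim (μ.map (delayMap T k h)) (delayMap T k h x)
    exact ⟨le_antisymm (hle.trans hup) hlo, le_antisymm hup (hlo.trans hle)⟩
  · exact MeasurableSet.iInter fun p => MeasurableSet.iInter fun M => MeasurableSet.iInter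
      fun c => measurableSet_lt (measurable_energySum μ hL.continuous k _ _ _) measurable_const
  · simp only [Set.mem_iInter]
    refine ae_all_iff.2 fun p => ae_all_iff.2 fun M => ae_all_iff.2 fun c => ?_
    exact ae_energySum_lt_top μ hL.continuous hw hs hk c.2
      (by exact_mod_cast p.2.1.trans p.2.2.1.le) (by exact_mod_cast p.2.2.2)
      (by exact_mod_cast p.2.2.1) M v
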